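/- Let $k$ and $n$ be positive integers with $n>k$, and let $0\le j\le n$. The $k$-uniform tight cycle $C_{n,k}$ is the hypergraph on the vertex set $\mathbb{Z}_n$ whose edges are the sets $\{i,i+1,\dots,i+k-1\}$ for $0\le i\le n-1$. Let $C_{n,k}^{(j)}$ be the hypergraph on $\mathbb{Z}_n$ obtained from $C_{n,k}$ by deleting the $j$ edges $\{s,\dots,s+k-1\}$ for $0\le s\le j-1$, so that $C_{n,k}^{(0)}=C_{n,k}$. For a hypergraph $\mathcal{H}$ on a finite vertex set $V$, let $\mathrm{NC}(\mathcal{H})$ be the abstract simplicial complex on $V$ whose faces are the noncovers of $\mathcal{H}$, i.e. the sets $W\subseteq V$ that are disjoint from at least one edge of $\mathcal{H}$. If $j=n$, then $\mathrm{NC}(C_{n,k}^{(j)})$ is the void complex, i.e. it has no faces, not even the empty one. If $k\le j<n$, then (the geometric realization of) $\mathrm{NC}(C_{n,k}^{(j)})$ is contractible. If $0\le j\le k-1$, then up to homotopy equivalence \[ \mathrm{NC}(C_{n,k}^{(j)})\simeq \begin{cases} \displaystyle\bigvee_{k-j} S^{2q} & \text{if } n=(q+1)(k+1) \text{ for some integer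 } q\ge 0,\\ S^{2q+1} & \text{if } n=(q+1)(k+1)+t \text{ for some integers } q\ge 0 \text{ and } j<t\le k,\\ * & \text{otherwise,} \end{cases} \] where $\bigvee_{k-j} S^{2q}$ is the wedge of $k-j$ copies of the $2q$-dimensional sphere and $*$ is a point. -/

import Mathlib

namespace Noncover

/-- An abstract simplicial complex on `V`: a family of finite subsets of `V` closed under taking
subsets. The void complex `⊥`, with no face at all, differs from the complex whose only face is
the empty set. -/
abbrev SimplicialComplex (V : Type*) : Type _ := LowerSet (Finset V)

/-- A vertex subset `W` is a cover of `H` if it meets every edge of `H`. -/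
def IsCover {V : Type*} (H : Hypergraph V) (W : Set V) : Prop :=
  W ⊆ H.vertexSet ∧ ∀ e ∈ H.edgeSet, (W ∩ e).Nonempty

/-- The complex of all noncovers of `H`: the vertex subsets that are not covers. -/
def noncoverComplex {V : Type*} (H : Hypergraph V) : SimplicialComplex V where
  carrier := {W | (W : Set V) ⊆ H.vertexSet ∧ ¬ IsCover H W}
  lower' := fun _ _ hle hW =>
    have hsub := Finset.coe_subset.mpr hle
    ⟨hsub.trans hW.1, fun hcov => hW.2 ⟨hW.1, fun e he =>
      (hcov.2 e he).mono (Set.inter_subset_inter_left e hsub)⟩⟩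

/-- The geometric realization of a simplicial complex on a finite vertex set, with the subspace
topology from `V → ℝ`: the points of the standard simplex (barycentric coordinates) whose support
is contained in a face. -/
def realization {V : Type*} [Fintype V] (K : SimplicialComplex V) : Set (V → ℝ) :=
  {x | x ∈ stdSimplex ℝ V ∧ ∃ σ ∈ K, ∀ v, v ∉ σ → x v = 0}

/-- The set `{i, i + 1, …, i + k - 1}` of residues modulo `n`. -/
def tightEdge (n k i : ℕ) : Set (ZMod n) :=
  {v | ∃ a : ℕ, a < k ∧ v = ((i + a : ℕ) : ZMod n)}

/-- The `k`-uniform tight cycle on `ℤ/n` (used for `0 < k < n`). -/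
def tightCycle (n k : ℕ) : Hypergraph (ZMod n) where
  vertexSet := Set.univ
  edgeSet := {e | ∃ i : ℕ, i < n ∧ e = tightEdge n k i}
  subset_vertexSet_of_mem_edgeSet' := fun _ _ => Set.subset_univ _

/-- The tight cycle with the `j` edges `{s, …, s + k - 1}`, `0 ≤ s ≤ j - 1`, deleted; the vertex
set is unchanged. -/
def tightCycleDel (n k j : ℕ) : Hypergraph (ZMod n) where
  vertexSet := Set.univ
  edgeSet := (tightCycle n k).edgeSet \ {e | ∃ s : ℕ, s < j ∧ e = tightEdge n k s}
  subset_vertexSet_of_mem_edgeSet' := fun _ _ => Set.subset_univ _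

theorem tightCycleDel_zero (n k : ℕ) : tightCycleDel n k 0 = tightCycle n k := by
  simp [tightCycleDel, tightCycle]

/-- The unit sphere `S^d` in `ℝ^(d+1)`. -/
abbrev Sphere (d : ℕ) : Type :=
  Metric.sphere (0 : EuclideanSpace ℝ (Fin (d + 1))) 1

/-- The base point `(1, 0, …, 0)` of `S^d`. -/
noncomputable def Sphere.base (d : ℕ) : Sphere d :=
  ⟨EuclideanSpace.single 0 1, by simp⟩

/-- The relation on a disjoint union of pointed spaces that identifies all base points. -/
inductive WedgeRel {ι : Type*} {X : ι → Type*} (p : ∀ i, X i) : (Σ i, X i) → (Σ i, X i) → Prop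
  | glue (i i' : ι) : WedgeRel p ⟨i, p i⟩ ⟨i', p i'⟩

/-- The wedge sum of a non-empty family of pointed spaces: the quotient of the disjoint union
by the identification of all base points, with the quotient topology. -/
abbrev Wedge {ι : Type*} {X : ι → Type*} (p : ∀ i, X i) : Type _ :=
  Quot (WedgeRel p)

/-- The wedge of `m ≥ 1` copies of `S^d`. -/
abbrev SphereWedge (m d : ℕ) : Type :=
  Wedge fun _ : Fin m => Sphere.base d

end Noncover

/-! After relabelling `ZMod n` by `Fin n`, the case `k ≤ j < n` is immediate: vertex `k - 1` lies in
no remaining edge, so the complex is a cone. For `j < k` the proof rests on a periodicity and on the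
computation for `k < n ≤ 2k + 1`.

Periodicity (`cycleComplex_homotopyEquiv_susp_susp`): passing from `n` to `n + k + 1` suspends the
complex twice. The edge set of the long cycle is changed, without changing the homotopy type, until
it consists of all edges of the short cycle on `0, …, n - 1` together with the two long edges
starting at `n` and `n + 1`. After the vertices common to these two are discarded, they become the
singletons `{n}` and `{n + k}`, disjoint from the short cycle. Each singleton contributes one
suspension, because a union of two cones is the suspension of their intersection
(`IsCone.sup_homotopyEquiv_susp`). All modifications come from `homotopyEquiv_of_collapse`: if the
faces outside a subcomplex are paired by toggling one vertex, the complex retracts onto it.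

Base case `n = k + 1 + t`, `0 ≤ t ≤ k`: the facets are the complements of the edges, that is, `n -
j` arcs of `t + 1` vertices. For `t = 0` they are `k + 1 - j` points. For `1 ≤ t` the arc `[0, t]`
may be fattened to `[0, k]`. Then the complex is a cone if `t ≤ j`, and a union of two cones meeting
in two disjoint simplices, hence a circle, if `j < t`.

Suspensions are tracked by the model `fan m d`, consisting of `m + 1` half-spheres with a common
equator. It satisfies `susp (fan m d) ≃ₜ fan m (d + 1)` and is compared with the wedge of `m`
spheres at the end. -/

namespace Noncover
open scoped ContinuousMap
open Finset

/-! ### Deformation retractions and cones for realizations -/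

/-- A retraction joined to the identity by segments inside the set is a homotopy equivalence. -/
theorem homotopyEquiv_of_segment {E : Type*} [AddCommGroup E] [Module ℝ E] [TopologicalSpace E]
    [ContinuousAdd E] [ContinuousSMul ℝ E] {S S₀ : Set E} (hS : S₀ ⊆ S) (r : E → E)
    (hr : Continuous r) (hmap : ∀ x ∈ S, r x ∈ S₀) (hid : ∀ x ∈ S₀, r x = x)
    (hseg : ∀ x ∈ S, ∀ θ ∈ Set.Icc (0 : ℝ) 1, (1 - θ) • x + θ • r x ∈ S) :
    Nonempty (S ≃ₕ S₀) := by
  refine ⟨⟨⟨fun x => ⟨r x, hmap _ x.2⟩, by fun_prop⟩, ⟨fun x => ⟨x, hS x.2⟩, by fun_prop⟩,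
    ⟨ContinuousMap.Homotopy.symm ⟨⟨fun p => ⟨(1 - (p.1 : ℝ)) • (p.2 : E) + (p.1 : ℝ) • r p.2,
      hseg _ p.2.2 _ p.1.2⟩, by fun_prop⟩, ?_, ?_⟩⟩, ?_⟩⟩
  · intro x; ext; simp
  · intro x; ext; simp
  · have : (ContinuousMap.comp ⟨fun x : S => (⟨r x, hmap _ x.2⟩ : S₀), by fun_prop⟩
        ⟨fun x : S₀ => (⟨x, hS x.2⟩ : S), by fun_prop⟩) = ContinuousMap.id S₀ := by
      ext x; simpa using hid x x.2
    rw [this]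

section
variable {V : Type*} [Fintype V]

open Classical in
/-- The support of a point as a finite set of vertices. -/
noncomputable def supp (x : V → ℝ) : Finset V := univ.filter fun v => x v ≠ 0

theorem mem_supp {x : V → ℝ} {v : V} : v ∈ supp x ↔ x v ≠ 0 := by simp [supp]

theorem mem_realization {K : SimplicialComplex V} {x : V → ℝ} :
    x ∈ realization K ↔ x ∈ stdSimplex ℝ V ∧ supp x ∈ K := by
  constructor
  · rintro ⟨h, σ, hσ, hx⟩
    exact ⟨h, K.lower (fun v hv => by_contra fun h => mem_supp.1 hv (hx v h)) hσ⟩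
  · rintro ⟨h, hs⟩
    exact ⟨h, _, hs, fun v hv => by simpa [mem_supp] using hv⟩

theorem realization_mono {K L : SimplicialComplex V} (h : K ≤ L) :
    realization K ⊆ realization L := fun _ ⟨hx, σ, hσ, h'⟩ => ⟨hx, σ, h hσ, h'⟩

open Classical in
/-- The total weight of `x` off `w` and off the best face of `K₀`. -/
noncomputable def excess (K₀ : SimplicialComplex V) (h0 : ∅ ∈ K₀) (w : V) (x : V → ℝ) : ℝ :=
  (univ.filter (· ∈ K₀)).inf' ⟨∅, by simpa using h0⟩
    fun σ => ∑ v ∈ univ.filter (fun v => v ∉ σ ∧ v ≠ w), x v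

open Classical in
/-- Lower all coordinates except `w` by the excess and give the weight to `w`. -/
noncomputable def pushTo (K₀ : SimplicialComplex V) (h0 : ∅ ∈ K₀) (w : V) (x : V → ℝ) : V → ℝ :=
  fun v => if v = w then 1 - ∑ u ∈ univ.erase w, max (x u - excess K₀ h0 w x) 0
    else max (x v - excess K₀ h0 w x) 0

theorem continuous_excess (K₀ : SimplicialComplex V) (h0 : ∅ ∈ K₀) (w : V) :
    Continuous (excess K₀ h0 w) := by
  unfold excess
  apply Continuous.finset_inf'_apply
  intro σ _
  fun_prop

theorem continuous_pushTo (K₀ : SimplicialComplex V) (h0 : ∅ ∈ K₀) (w : V) :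
    Continuous (pushTo K₀ h0 w) := by
  have := continuous_excess K₀ h0 w
  refine continuous_pi fun v => ?_
  by_cases h : v = w
  · simp only [pushTo, h, if_true]; fun_prop
  · simp only [pushTo, h, if_false]; fun_prop

theorem excess_nonneg (K₀ : SimplicialComplex V) (h0 : ∅ ∈ K₀) (w : V) {x : V → ℝ}
    (hx : ∀ v, 0 ≤ x v) : 0 ≤ excess K₀ h0 w x :=
  Finset.le_inf' _ _ fun _ _ => Finset.sum_nonneg fun v _ => hx v

/-- A face attaining the minimum works: a coordinate at a vertex other than `w` outside it is one
term of the nonnegative sum that equals the excess, so it cannot be larger. -/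
theorem exists_excess_face (K₀ : SimplicialComplex V) (h0 : ∅ ∈ K₀) (w : V) {x : V → ℝ}
    (hx : ∀ v, 0 ≤ x v) : ∃ σ ∈ K₀, ∀ v, v ≠ w → excess K₀ h0 w x < x v → v ∈ σ := by
  classical
  obtain ⟨σ, hσ, h⟩ := Finset.exists_mem_eq_inf' (s := univ.filter (· ∈ K₀))
    ⟨∅, by simpa using h0⟩ fun σ => ∑ v ∈ univ.filter (fun v => v ∉ σ ∧ v ≠ w), x v
  refine ⟨σ, by simpa using hσ, fun v hvw hv => by_contra fun hvσ => ?_⟩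
  have : x v ≤ ∑ v ∈ univ.filter (fun v => v ∉ σ ∧ v ≠ w), x v :=
    Finset.single_le_sum (f := x) (fun v _ => hx v) (by simp [hvσ, hvw])
  have h2 : excess K₀ h0 w x = _ := h
  convert absurd hv _
  rw [h2, not_lt]
  convert this

/-- The support of `x` itself competes in the minimum with sum zero, so the excess vanishes. -/
theorem pushTo_eq_self (K₀ : SimplicialComplex V) (h0 : ∅ ∈ K₀) (w : V) {x : V → ℝ}
    (hx : x ∈ stdSimplex ℝ V) (h : supp x ∈ K₀) : pushTo K₀ h0 w x = x := by
  classical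
  have he : excess K₀ h0 w x = 0 := by
    refine le_antisymm ?_ (excess_nonneg _ _ _ hx.1)
    refine (Finset.inf'_le _ (b := supp x) (by simpa using h)).trans (le_of_eq ?_)
    refine Finset.sum_eq_zero fun v hv => ?_
    simp only [mem_filter, mem_supp, not_not] at hv
    exact hv.2.1
  funext v
  have h1 : ∀ u, max (x u) 0 = x u := fun u => max_eq_left (hx.1 u)
  simp only [pushTo, he, sub_zero, h1]
  split_ifs with hv
  · subst hv
    have := Finset.add_sum_erase univ x (mem_univ v)
    rw [hx.2] at this
    linarith
  · rfl

theorem pushTo_mem_stdSimplex (K₀ : SimplicialComplex V) (h0 : ∅ ∈ K₀) (w : V) {x : V → ℝ}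
    (hx : x ∈ stdSimplex ℝ V) : pushTo K₀ h0 w x ∈ stdSimplex ℝ V := by
  classical
  have he := excess_nonneg K₀ h0 w hx.1
  constructor
  · intro v
    simp only [pushTo]
    split_ifs with hv
    · have h1 : ∑ u ∈ univ.erase w, max (x u - excess K₀ h0 w x) 0 ≤ ∑ u ∈ univ.erase w, x u :=
        Finset.sum_le_sum fun u _ => max_le (by linarith) (hx.1 u)
      have h2 := Finset.add_sum_erase univ x (mem_univ w)
      rw [hx.2] at h2
      have := hx.1 w
      linarith
    · exact le_max_right _ _
  · rw [← Finset.add_sum_erase univ _ (mem_univ w)]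
    have : ∑ u ∈ univ.erase w, pushTo K₀ h0 w x u
        = ∑ u ∈ univ.erase w, max (x u - excess K₀ h0 w x) 0 :=
      Finset.sum_congr rfl fun u hu => by simp [pushTo, Finset.ne_of_mem_erase hu]
    rw [this]
    simp [pushTo]

/-- If the faces of `K` outside `K₀` are closed under adding and removing the vertex `w`, then
`K` deformation retracts onto `K₀`. -/
theorem homotopyEquiv_of_collapse [DecidableEq V] {K K₀ : SimplicialComplex V} (hK : K₀ ≤ K)
    (h0 : ∅ ∈ K₀) (w : V)
    (h : ∀ σ ∈ K, σ ∉ K₀ → insert w σ ∈ K ∧ σ.erase w ∉ K₀) :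
    Nonempty (realization K ≃ₕ realization K₀) := by
  -- The push can create new support only at `w`; hence the whole segment from `x` to its image
  -- lives on the face `insert w (supp x)`.
  have key : ∀ x ∈ realization K, supp x ∉ K₀ →
      supp (pushTo K₀ h0 w x) ⊆ insert w (supp x) := by
    intro x hx _ v hv
    rw [mem_insert, mem_supp]
    rw [mem_supp] at hv
    by_contra hcon
    push Not at hcon
    apply hv
    simp only [pushTo, hcon.1, if_false, hcon.2]
    have := excess_nonneg K₀ h0 w hx.1.1
    exact max_eq_right (by linarith)
  refine homotopyEquiv_of_segment (realization_mono hK) (pushTo K₀ h0 w)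
    (continuous_pushTo K₀ h0 w) ?_ ?_ ?_
  · intro x hx
    have hx' := mem_realization.1 hx
    by_cases hs : supp x ∈ K₀
    · rw [pushTo_eq_self _ _ _ hx'.1 hs]; exact mem_realization.2 ⟨hx'.1, hs⟩
    · refine mem_realization.2 ⟨pushTo_mem_stdSimplex _ _ _ hx'.1, ?_⟩
      have hins := (h _ hx'.2 hs).1
      have hK' : supp (pushTo K₀ h0 w x) ∈ K := K.lower (key x hx hs) hins
      by_contra hn
      obtain ⟨σ, hσ, hσ'⟩ := exists_excess_face K₀ h0 w hx'.1.1
      -- Off `w`, the pushed point is supported in the face `σ` of `K₀`. If its support were outside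
      -- `K₀`, erasing `w` would have to leave it outside, a contradiction.
      refine (h _ hK' hn).2 (K₀.lower (fun v hv => ?_) hσ)
      rw [mem_erase, mem_supp] at hv
      refine hσ' v hv.1 ?_
      by_contra hlt
      apply hv.2
      simp only [pushTo, hv.1, if_false]
      exact max_eq_right (by linarith)
  · intro x hx
    have hx' := mem_realization.1 hx
    exact pushTo_eq_self _ _ _ hx'.1 hx'.2
  · intro x hx θ hθ
    have hx' := mem_realization.1 hx
    by_cases hs : supp x ∈ K₀
    · rw [pushTo_eq_self _ _ _ hx'.1 hs, ← add_smul]; simpa using hx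
    · refine ⟨convex_stdSimplex ℝ V hx'.1 (pushTo_mem_stdSimplex K₀ h0 w hx'.1)
        (by linarith [hθ.2]) hθ.1 (by ring), _, (h _ hx'.2 hs).1, fun v hv => ?_⟩
      have h1 : pushTo K₀ h0 w x v = 0 := by
        by_contra hne
        exact hv (key x hx hs (mem_supp.2 hne))
      have h2 : x v = 0 := by
        by_contra hne
        exact hv (mem_insert_of_mem (mem_supp.2 hne))
      simp [h1, h2]

/-- A complex that is a cone with apex `p`. -/
def IsCone [DecidableEq V] (K : SimplicialComplex V) (p : V) : Prop :=
  {p} ∈ K ∧ ∀ σ ∈ K, insert p σ ∈ K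

theorem IsCone.contractibleSpace [DecidableEq V] {K : SimplicialComplex V} {p : V}
    (h : IsCone K p) : ContractibleSpace (realization K) := by
  have hp : Pi.single p (1 : ℝ) ∈ realization K :=
    ⟨single_mem_stdSimplex ℝ p, {p}, h.1, fun v hv => by
      simp only [mem_singleton] at hv
      simp [hv]⟩
  refine StarConvex.contractibleSpace (x := Pi.single p (1 : ℝ)) ?_ ⟨_, hp⟩
  intro y hy a b ha hb hab
  have hy' := mem_realization.1 hy
  refine ⟨convex_stdSimplex ℝ V hp.1 hy'.1 ha hb hab, _, h.2 _ hy'.2, fun v hv => ?_⟩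
  simp only [mem_insert, mem_supp, not_or, not_not] at hv
  simp [hv.1, hv.2]

end

/-- Realizations are unchanged by an injective relabelling of the vertices. -/
theorem homeomorph_of_relabel {V V' : Type*} [Fintype V] [Fintype V'] (f : V' ↪ V)
    {K' : SimplicialComplex V'} {K : SimplicialComplex V}
    (h : ∀ σ, σ ∈ K' ↔ σ.map f ∈ K) (hr : ∀ σ ∈ K, ∀ v ∈ σ, v ∈ Set.range f) :
    Nonempty (realization K ≃ₜ realization K') := by
  classical
  have hsupp : ∀ x ∈ realization K, ∀ v, v ∉ Set.range f → x v = 0 := by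
    rintro x ⟨-, σ, hσ, hx⟩ v hv
    exact hx v fun hvσ => hv (hr σ hσ v hvσ)
  have hext : ∀ (y : V' → ℝ) v', Function.extend f y 0 (f v') = y v' :=
    fun y v' => f.injective.extend_apply _ _ _
  have hext0 : ∀ (y : V' → ℝ) v, v ∉ Set.range f → Function.extend f y 0 v = 0 :=
    fun y v hv => Function.extend_apply' _ _ _ (by simpa using hv)
  have hsum : ∀ x : V → ℝ, (∀ v, v ∉ Set.range f → x v = 0) → ∑ v, x v = ∑ v', x (f v') := by
    intro x hx
    rw [← Finset.sum_map univ f x]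
    refine (Finset.sum_subset (Finset.subset_univ _) fun v _ hv => hx v ?_).symm
    simpa using hv
  refine ⟨⟨⟨fun x => ⟨fun v' => x.1 (f v'), ?_⟩, fun y => ⟨Function.extend f y.1 0, ?_⟩, ?_, ?_⟩,
    ?_, ?_⟩⟩
  · have hx := mem_realization.1 x.2
    refine ⟨⟨fun v => hx.1.1 _, ?_⟩, (supp x.1).preimage f f.injective.injOn, ?_, ?_⟩
    · rw [← hsum x.1 (hsupp _ x.2), hx.1.2]
    · rw [h]
      refine K.lower ?_ hx.2
      intro v hv
      simp only [mem_map, mem_preimage] at hv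
      obtain ⟨a, ha, rfl⟩ := hv
      exact ha
    · intro v hv
      simpa [mem_supp] using hv
  · have hy := mem_realization.1 y.2
    refine ⟨⟨fun v => ?_, ?_⟩, (supp y.1).map f, (h _).1 hy.2, ?_⟩
    · by_cases hv : v ∈ Set.range f
      · obtain ⟨a, rfl⟩ := hv
        rw [hext]; exact hy.1.1 _
      · rw [hext0 _ _ hv]
    · rw [hsum _ (hext0 _)]
      simp only [hext]
      exact hy.1.2
    · intro v hv
      by_cases hvr : v ∈ Set.range f
      · obtain ⟨a, rfl⟩ := hvr
        rw [hext]
        by_contra hne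
        exact hv (mem_map_of_mem f (mem_supp.2 hne))
      · exact hext0 _ _ hvr
  · intro x
    ext v
    by_cases hv : v ∈ Set.range f
    · obtain ⟨a, rfl⟩ := hv
      exact hext _ a
    · exact (hext0 _ _ hv).trans (hsupp _ x.2 v hv).symm
  · intro y
    ext v
    exact hext _ v
  · have hc : Continuous fun (x : V → ℝ) v' => x (f v') := by fun_prop
    exact (hc.comp continuous_subtype_val).subtype_mk _
  · refine Continuous.subtype_mk (continuous_pi fun v => ?_) _
    by_cases hv : v ∈ Set.range f
    · obtain ⟨a, rfl⟩ := hv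
      simp only [hext]
      exact (continuous_apply a).comp continuous_subtype_val
    · simp only [hext0 _ _ hv]; fun_prop

/-! ### Suspension of bounded sets as a homotopy functor -/

section Suspension
variable {E F G : Type*} [NormedAddCommGroup E] [NormedSpace ℝ E] [NormedAddCommGroup F]
  [NormedSpace ℝ F] [NormedAddCommGroup G] [NormedSpace ℝ G]

/-- The suspension of a bounded set `X ⊆ E`, as a subset of `E × ℝ`. -/
def susp (X : Set E) : Set (E × ℝ) :=
  {p | |p.2| ≤ 1 ∧ (|p.2| = 1 → p.1 = 0) ∧ (|p.2| < 1 → (1 - |p.2|)⁻¹ • p.1 ∈ X)}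

open Classical in
/-- The first coordinate of the suspension of the map `f`. -/
noncomputable def suspFun {X : Set E} {Y : Set F} (f : X → Y) (p : E × ℝ) : F :=
  (1 - |p.2|) • if h : (1 - |p.2|)⁻¹ • p.1 ∈ X then (f ⟨_, h⟩ : F) else 0

theorem suspFun_mem {X : Set E} {Y : Set F} (f : X → Y) {p : E × ℝ} (hp : p ∈ susp X) :
    (suspFun f p, p.2) ∈ susp Y := by
  refine ⟨hp.1, fun h => ?_, fun h => ?_⟩
  · simp only at h
    simp [suspFun, h]
  · simp only at h
    have h1 : (1 - |p.2|) ≠ 0 := by linarith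
    simp only [suspFun, dif_pos (hp.2.2 h), smul_smul, inv_mul_cancel₀ h1, one_smul]
    exact Subtype.property _

theorem suspFun_eq {X : Set E} {Y : Set F} (f : X → Y) {p : E × ℝ} (x : X)
    (h : (1 - |p.2|)⁻¹ • p.1 = x) : suspFun f p = (1 - |p.2|) • (f x : F) := by
  have hx : (1 - |p.2|)⁻¹ • p.1 ∈ X := h ▸ x.2
  have : (⟨_, hx⟩ : X) = x := Subtype.ext h
  simp only [suspFun, dif_pos hx, this]

theorem suspFun_comp {X : Set E} {Y : Set F} {Z : Set G} (f : X → Y) (g : Y → Z) {p : E × ℝ}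
    (hp : p ∈ susp X) : suspFun g (suspFun f p, p.2) = suspFun (g ∘ f) p := by
  rcases hp.1.lt_or_eq with h | h
  · have h1 : (1 - |p.2|) ≠ 0 := by linarith
    rw [suspFun_eq (g ∘ f) ⟨_, hp.2.2 h⟩ rfl, suspFun_eq g (f ⟨_, hp.2.2 h⟩), Function.comp]
    rw [suspFun_eq f ⟨_, hp.2.2 h⟩ rfl, smul_smul, inv_mul_cancel₀ h1, one_smul]
  · simp [suspFun, h]

theorem suspFun_id {X : Set E} {p : E × ℝ} (hp : p ∈ susp X) :
    suspFun (id : X → X) p = p.1 := by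
  rcases hp.1.lt_or_eq with h | h
  · have h1 : (1 - |p.2|) ≠ 0 := by linarith
    simp only [suspFun, dif_pos (hp.2.2 h), id, smul_smul, mul_inv_cancel₀ h1, one_smul]
  · simp [suspFun, h, hp.2.1 h]

/-- Away from the poles this is a composite of continuous maps; at a pole the value is squeezed to
zero by `(1 - |s|)` times a bound for `Y`. The parameter space `T` lets the same statement serve for
maps and for homotopies. -/
theorem continuous_suspFun {T : Type*} [TopologicalSpace T] {X : Set E} {Y : Set F}
    (hY : Bornology.IsBounded Y) (f : C(T × X, Y)) :
    Continuous fun q : T × susp X => suspFun (fun x => f (q.1, x)) q.2.1 := by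
  rw [continuous_iff_continuousAt]
  rintro ⟨t, p, hp⟩
  rcases hp.1.lt_or_eq with h | h
  · let U : Set (T × susp X) := {q | |q.2.1.2| < 1}
    have hU : IsOpen U := isOpen_lt (by fun_prop) (by fun_prop)
    have hc : ContinuousOn
        (fun q : T × susp X => suspFun (fun x => f (q.1, x)) q.2.1) U := by
      rw [continuousOn_iff_continuous_domRestrict]
      have hmem : ∀ q : U, (1 - |q.1.2.1.2|)⁻¹ • q.1.2.1.1 ∈ X := fun q => q.1.2.2.2.2 q.2
      have heq : U.domRestrict (fun q : T × susp X => suspFun (fun x => f (q.1, x)) q.2.1) =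
          fun q : U => (1 - |q.1.2.1.2|) • (f (q.1.1, ⟨_, hmem q⟩) : F) := by
        funext q
        simp only [Set.domRestrict_apply, suspFun, dif_pos (hmem q)]
      rw [heq]
      have hne : ∀ q : U, 1 - |q.1.2.1.2| ≠ 0 := fun q => by
        have := q.2
        simp only [U, Set.mem_ofPred_eq] at this
        linarith
      have hcont : Continuous fun q : U => (1 - |q.1.2.1.2|)⁻¹ • q.1.2.1.1 :=
        Continuous.smul (Continuous.inv₀ (by fun_prop) hne) (by fun_prop)
      refine Continuous.smul (by fun_prop) (continuous_subtype_val.comp (f.continuous.comp ?_))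
      exact Continuous.prodMk (by fun_prop) (hcont.subtype_mk _)
    exact hc.continuousAt (hU.mem_nhds h)
  · obtain ⟨C, hC⟩ := hY.exists_norm_le
    have h0 : suspFun (fun x => f (t, x)) p = 0 := by simp [suspFun, h]
    rw [ContinuousAt, h0]
    refine squeeze_zero_norm (a := fun q : T × susp X => abs (1 - abs q.2.1.2) * max C 0) ?_ ?_
    · intro q
      simp only [suspFun, norm_smul, Real.norm_eq_abs]
      refine mul_le_mul_of_nonneg_left ?_ (abs_nonneg _)
      split_ifs with hq
      · exact (hC _ (Subtype.property _)).trans (le_max_left _ _)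
      · simp
    · have : Continuous fun q : T × susp X => abs (1 - abs q.2.1.2) * max C 0 := by fun_prop
      have h2 := this.tendsto (t, ⟨p, hp⟩)
      simpa [h] using h2

theorem isBounded_susp {X : Set E} (hX : Bornology.IsBounded X) :
    Bornology.IsBounded (susp X) := by
  obtain ⟨C, hC⟩ := hX.exists_norm_le
  refine isBounded_iff_forall_norm_le.2 ⟨max (max C 0) 1, ?_⟩
  rintro ⟨y, s⟩ ⟨h1, h2, h3⟩
  simp only at h1 h2 h3
  refine max_le ?_ (h1.trans (le_max_right _ _))
  refine le_trans ?_ (le_max_left _ _)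
  rcases h1.lt_or_eq with h | h
  · have h4 := hC _ (h3 h)
    rw [norm_smul, norm_inv, Real.norm_of_nonneg (by linarith), inv_mul_le_iff₀ (by linarith)] at h4
    refine h4.trans ((mul_le_mul_of_nonneg_left (le_max_left C 0) (by linarith)).trans ?_)
    exact mul_le_of_le_one_left (le_max_right _ _) (by linarith [abs_nonneg s])
  · simp [h2 h]

/-- Suspension of maps. -/
noncomputable def suspMap {X : Set E} {Y : Set F} (hY : Bornology.IsBounded Y) (f : C(X, Y)) :
    C(susp X, susp Y) where
  toFun p := ⟨(suspFun f p.1, p.1.2), suspFun_mem f p.2⟩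
  continuous_toFun := by
    have := (continuous_suspFun (T := Unit) hY (f.comp ⟨Prod.snd, continuous_snd⟩)).comp
      (Continuous.prodMk (continuous_const (y := ())) (continuous_id (X := susp X)))
    refine Continuous.subtype_mk (Continuous.prodMk ?_ (by fun_prop)) _
    exact this

theorem suspMap_homotopic {X : Set E} {Y : Set F} (hY : Bornology.IsBounded Y) {f g : C(X, Y)}
    (h : f.Homotopic g) : (suspMap hY f).Homotopic (suspMap hY g) := by
  obtain ⟨H⟩ := h
  refine ⟨⟨⟨fun q => ⟨(suspFun (fun x => H (q.1, x)) q.2.1, q.2.1.2), suspFun_mem _ q.2.2⟩, ?_⟩,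
    ?_, ?_⟩⟩
  · exact Continuous.subtype_mk (Continuous.prodMk (continuous_suspFun hY H.toContinuousMap)
      (by fun_prop)) _
  · intro p; simp [suspMap]
  · intro p; simp [suspMap]

theorem susp_homotopyEquiv {X : Set E} {Y : Set F} (hX : Bornology.IsBounded X)
    (hY : Bornology.IsBounded Y) (h : Nonempty (X ≃ₕ Y)) : Nonempty (susp X ≃ₕ susp Y) := by
  obtain ⟨e⟩ := h
  refine ⟨⟨suspMap hY e.toFun, suspMap hX e.invFun, ?_, ?_⟩⟩
  · have h1 := suspMap_homotopic hX e.left_inv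
    convert h1 using 1
    · ext p
      · exact suspFun_comp _ _ p.2
      · rfl
    · ext p <;> simp [suspMap, suspFun_id p.2]
  · have h1 := suspMap_homotopic hY e.right_inv
    convert h1 using 1
    · ext p
      · exact suspFun_comp _ _ p.2
      · rfl
    · ext p <;> simp [suspMap, suspFun_id p.2]

theorem contractibleSpace_of_homotopyEquiv {X Y : Type*} [TopologicalSpace X]
    [TopologicalSpace Y] (h : Nonempty (X ≃ₕ Y)) [ContractibleSpace Y] : ContractibleSpace X :=
  h.some.contractibleSpace

/-- By homotopy invariance `X` may be replaced by a point, whose suspension is a segment. -/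
theorem susp_contractible {X : Set E} (hX : Bornology.IsBounded X) [ContractibleSpace X] :
    ContractibleSpace (susp X) := by
  have h1 : Nonempty (X ≃ₕ ({0} : Set ℝ)) := by
    have : ContractibleSpace ({0} : Set ℝ) :=
      (convex_singleton (0 : ℝ)).contractibleSpace (Set.singleton_nonempty _)
    exact ContractibleSpace.hequiv _ _
  have h2 : susp ({0} : Set ℝ) = {0} ×ˢ Set.Icc (-1 : ℝ) 1 := by
    ext ⟨y, s⟩
    simp only [susp, Set.mem_ofPred_eq, Set.mem_singleton_iff, smul_eq_mul, mul_eq_zero,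
      inv_eq_zero, Set.mem_prod, Set.mem_Icc, ← abs_le]
    constructor
    · rintro ⟨a, b, c⟩
      refine ⟨?_, a⟩
      rcases a.lt_or_eq with h | h
      · rcases c h with h' | h'
        · linarith
        · exact h'
      · exact b h
    · rintro ⟨rfl, h⟩
      exact ⟨h, fun _ => rfl, fun _ => Or.inr rfl⟩
  have h3 : ContractibleSpace (susp ({0} : Set ℝ)) := by
    rw [h2]
    exact ((convex_singleton (0 : ℝ)).prod (convex_Icc _ _)).contractibleSpace ⟨(0, 0), by simp⟩
  exact contractibleSpace_of_homotopyEquiv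
    (susp_homotopyEquiv hX Bornology.isBounded_singleton h1)

end Suspension

/-! ### Unions of two cones -/

section
variable {V : Type*} [Fintype V]

theorem isBounded_realization (K : SimplicialComplex V) :
    Bornology.IsBounded (realization K) :=
  (bounded_stdSimplex V).subset fun _ hx => hx.1

/-- The union of `P`, a cone over `Q` and a cone over `R`, with two new vertices. -/
def biCone {V : Type*} (P Q R : SimplicialComplex V) : SimplicialComplex (V ⊕ Bool) where
  carrier := {σ | (Sum.inr true ∉ σ ∧ Sum.inr false ∉ σ ∧ σ.toLeft ∈ P) ∨
    (Sum.inr false ∉ σ ∧ σ.toLeft ∈ Q) ∨ (Sum.inr true ∉ σ ∧ σ.toLeft ∈ R)}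
  lower' := by
    intro σ τ h hσ
    have h' : τ.toLeft ≤ σ.toLeft := Finset.toLeft_subset_toLeft h
    rcases hσ with ⟨h1, h2, h3⟩ | ⟨h1, h2⟩ | ⟨h1, h2⟩
    · exact Or.inl ⟨fun h4 => h1 (h h4), fun h4 => h2 (h h4), P.lower h' h3⟩
    · exact Or.inr (Or.inl ⟨fun h4 => h1 (h h4), Q.lower h' h2⟩)
    · exact Or.inr (Or.inr ⟨fun h4 => h1 (h h4), R.lower h' h2⟩)

theorem mem_biCone {V : Type*} {P Q R : SimplicialComplex V} {σ : Finset (V ⊕ Bool)} :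
    σ ∈ biCone P Q R ↔ (Sum.inr true ∉ σ ∧ Sum.inr false ∉ σ ∧ σ.toLeft ∈ P) ∨
    (Sum.inr false ∉ σ ∧ σ.toLeft ∈ Q) ∨ (Sum.inr true ∉ σ ∧ σ.toLeft ∈ R) := Iff.rfl

/-- The height is the difference of the two cone coordinates. No face contains both cone points, so
its absolute value is their sum and the two can be recovered as positive and negative parts. The
hypothesis `∅ ∈ L` is essential: without it the left side is empty, while the suspension still has
its poles. -/
theorem realization_biCone_homeomorph (L : SimplicialComplex V) (h0 : ∅ ∈ L) :
    Nonempty (realization (biCone ⊥ L L) ≃ₜ susp (realization L)) := by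
  classical
  have hmem : ∀ x : V ⊕ Bool → ℝ, x ∈ realization (biCone ⊥ L L) ↔ x ∈ stdSimplex ℝ (V ⊕ Bool) ∧
      (x (.inr true) = 0 ∨ x (.inr false) = 0) ∧ supp (fun v => x (.inl v)) ∈ L := by
    intro x
    have : (supp x).toLeft = supp fun v => x (.inl v) := by
      ext v; simp [mem_supp]
    rw [mem_realization, mem_biCone, this]
    simp only [mem_supp, not_not, LowerSet.notMem_bot]
    tauto
  have hsc : ∀ (c : ℝ) (y : V → ℝ), c ≠ 0 → supp (c • y) = supp y := by
    intro c y hc; ext v; simp [mem_supp, hc]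
  refine ⟨⟨⟨fun x => ⟨(fun v => x.1 (.inl v), x.1 (.inr true) - x.1 (.inr false)), ?_⟩,
    fun p => ⟨Sum.elim p.1.1 fun b => if b then max p.1.2 0 else max (-p.1.2) 0, ?_⟩, ?_, ?_⟩,
    ?_, ?_⟩⟩
  · obtain ⟨⟨hn, hs⟩, hz, hL⟩ := (hmem _).1 x.2
    have habs : |x.1 (.inr true) - x.1 (.inr false)| = x.1 (.inr true) + x.1 (.inr false) := by
      rcases hz with h | h
      · simp [h, abs_of_nonneg (hn _)]
      · simp [h, abs_of_nonneg (hn _)]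
    rw [Fintype.sum_sum_type, Fintype.sum_bool] at hs
    have hl : 0 ≤ ∑ v, x.1 (.inl v) := Finset.sum_nonneg fun v _ => hn _
    refine ⟨?_, ?_, ?_⟩
    · simp only [habs]; linarith
    · simp only [habs]
      intro h
      have : ∑ v, x.1 (.inl v) = 0 := by linarith
      rw [Finset.sum_eq_zero_iff_of_nonneg fun v _ => hn _] at this
      funext v
      exact this v (mem_univ _)
    · simp only [habs]
      intro h
      have hpos : 0 < 1 - (x.1 (.inr true) + x.1 (.inr false)) := by linarith
      rw [mem_realization, hsc _ _ (inv_ne_zero hpos.ne')]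
      refine ⟨⟨fun v => mul_nonneg (inv_nonneg.2 hpos.le) (hn _), ?_⟩, hL⟩
      simp only [Pi.smul_apply, smul_eq_mul, ← Finset.mul_sum]
      rw [inv_mul_eq_one₀ hpos.ne']
      linarith
  · obtain ⟨⟨y, s⟩, h1, h2, h3⟩ := p
    simp only at h1 h2 h3 ⊢
    rw [hmem]
    have key : (∀ v, 0 ≤ y v) ∧ ∑ v, y v = 1 - |s| ∧ supp y ∈ L := by
      rcases h1.lt_or_eq with h | h
      · have hpos : 0 < 1 - |s| := by linarith
        have := mem_realization.1 (h3 h)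
        rw [hsc _ _ (inv_ne_zero hpos.ne')] at this
        refine ⟨fun v => ?_, ?_, this.2⟩
        · have := this.1.1 v
          simp only [Pi.smul_apply, smul_eq_mul] at this
          exact nonneg_of_mul_nonneg_right this (inv_pos.2 hpos)
        · have := this.1.2
          simp only [Pi.smul_apply, smul_eq_mul, ← Finset.mul_sum] at this
          rwa [inv_mul_eq_one₀ hpos.ne', eq_comm] at this
      · have := h2 h
        subst this
        refine ⟨by simp, by simp [h], ?_⟩
        convert h0
        ext v; simp [mem_supp]
    have hmm : max s 0 + max (-s) 0 = |s| := by
      rcases le_total 0 s with h | h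
      · rw [max_eq_left h, max_eq_right (by linarith), abs_of_nonneg h, add_zero]
      · rw [max_eq_right h, max_eq_left (by linarith), abs_of_nonpos h, zero_add]
    refine ⟨⟨?_, ?_⟩, ?_, ?_⟩
    · rintro (v | b)
      · exact key.1 v
      · cases b <;> simp
    · rw [Fintype.sum_sum_type, Fintype.sum_bool]
      simp only [Sum.elim_inl, Sum.elim_inr, key.2.1]
      simp [hmm]
    · rcases le_total 0 s with h | h
      · right; simp [h]
      · left; simp [h]
    · exact key.2.2
  · intro x
    obtain ⟨⟨hn, hs⟩, hz, hL⟩ := (hmem _).1 x.2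
    ext v
    rcases v with v | b
    · rfl
    · rcases hz with h | h <;> cases b <;> simp [h, hn]
  · rintro ⟨⟨y, s⟩, hp⟩
    ext v
    · rfl
    · rcases le_total 0 s with h | h
      · simp [h]
      · simp [h]
  · refine Continuous.subtype_mk ?_ _
    have hc : Continuous fun x : V ⊕ Bool → ℝ =>
        ((fun v => x (.inl v)), x (.inr true) - x (.inr false)) := by fun_prop
    exact hc.comp continuous_subtype_val
  · refine Continuous.subtype_mk (continuous_pi fun v => ?_) _
    rcases v with v | b
    · exact (continuous_apply v).comp (continuous_fst.comp continuous_subtype_val)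
    · cases b
      · simp only [Sum.elim_inr]; simp only [Bool.false_eq_true, if_false]; fun_prop
      · simp only [Sum.elim_inr, if_true]; fun_prop

theorem toLeft_empty {α β : Type*} : (∅ : Finset (α ⊕ β)).toLeft = ∅ := by ext; simp

theorem toLeft_erase_inr {α β : Type*} [DecidableEq α] [DecidableEq β] (u : Finset (α ⊕ β))
    (b : β) : (u.erase (Sum.inr b)).toLeft = u.toLeft := by ext; simp

/-- The union of two cones is the suspension of their intersection. -/
theorem IsCone.sup_homotopyEquiv_susp [DecidableEq V] {A B : SimplicialComplex V} {a b : V}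
    (hA : IsCone A a) (hB : IsCone B b) :
    Nonempty (realization (A ⊔ B) ≃ₕ susp (realization (A ⊓ B))) := by
  have hA0 : ∅ ∈ A := A.lower (Finset.empty_subset _) hA.1
  have hB0 : ∅ ∈ B := B.lower (Finset.empty_subset _) hB.1
  have e0 : Nonempty (realization (biCone (A ⊔ B) ⊥ ⊥) ≃ₜ realization (A ⊔ B)) := by
    refine homeomorph_of_relabel ⟨Sum.inl, Sum.inl_injective⟩ (fun σ => ?_) (fun σ hσ v hv => ?_)
    · have : (σ.map ⟨Sum.inl, Sum.inl_injective⟩ : Finset (V ⊕ Bool)).toLeft = σ := by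
        ext v; simp
      rw [mem_biCone, this]
      simp
    · rcases v with v | v
      · simp
      · rw [mem_biCone] at hσ
        simp only [LowerSet.notMem_bot, and_false, or_false] at hσ
        cases v <;> tauto
  -- A new cone over `A` can be glued on for free: the added faces are paired by toggling the old
  -- apex `a`. The same holds for `B` and `b`.
  have e1 : Nonempty (realization (biCone (A ⊔ B) A ⊥) ≃ₕ realization (biCone (A ⊔ B) ⊥ ⊥)) := by
    refine homotopyEquiv_of_collapse ?_ ?_ (Sum.inl a) ?_
    · intro σ hσ
      change σ ∈ biCone _ _ _ at hσ
      change σ ∈ biCone _ _ _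
      revert hσ
      simp only [mem_biCone, LowerSet.notMem_bot, and_false, or_false]
      tauto
    · simp [mem_biCone, toLeft_empty, hA0]
    · intro σ
      have := hA.2 σ.toLeft
      simp only [mem_biCone, LowerSet.notMem_bot, and_false, or_false, LowerSet.mem_sup_iff,
        Finset.toLeft_insert_inl, mem_insert, mem_erase]
      simp
      tauto
  have e2 : Nonempty (realization (biCone (A ⊔ B) A B) ≃ₕ realization (biCone (A ⊔ B) A ⊥)) := by
    refine homotopyEquiv_of_collapse ?_ ?_ (Sum.inl b) ?_
    · intro σ hσ
      change σ ∈ biCone _ _ _ at hσ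
      change σ ∈ biCone _ _ _
      revert hσ
      simp only [mem_biCone, LowerSet.notMem_bot, and_false, or_false]
      tauto
    · simp [mem_biCone, toLeft_empty, hA0]
    · intro σ
      have := hB.2 σ.toLeft
      simp only [mem_biCone, LowerSet.notMem_bot, and_false, or_false, LowerSet.mem_sup_iff,
        Finset.toLeft_insert_inl, mem_insert, mem_erase]
      simp
      tauto
  -- Now the pairing is by the new cone point: the faces dropped are those whose old part lies in
  -- `A` but not in `B`. The next step drops those with old part in `B` but not in `A`, leaving two
  -- cones over `A ⊓ B`.
  have e3 : Nonempty (realization (biCone (A ⊔ B) A B) ≃ₕ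
      realization (biCone ⊥ (A ⊓ B) B)) := by
    refine homotopyEquiv_of_collapse ?_ ?_ (Sum.inr true) ?_
    · intro σ hσ
      change σ ∈ biCone _ _ _ at hσ
      change σ ∈ biCone _ _ _
      revert hσ
      simp only [mem_biCone, LowerSet.notMem_bot, and_false, false_or, LowerSet.mem_inf_iff]
      tauto
    · simp [mem_biCone, toLeft_empty, hA0, hB0]
    · intro σ
      simp only [mem_biCone, LowerSet.notMem_bot, and_false, false_or, LowerSet.mem_sup_iff,
        Finset.toLeft_insert_inr, mem_insert, mem_erase, LowerSet.mem_inf_iff,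
        toLeft_erase_inr]
      simp
      tauto
  have e4 : Nonempty (realization (biCone ⊥ (A ⊓ B) B) ≃ₕ
      realization (biCone ⊥ (A ⊓ B) (A ⊓ B))) := by
    refine homotopyEquiv_of_collapse ?_ ?_ (Sum.inr false) ?_
    · intro σ hσ
      change σ ∈ biCone _ _ _ at hσ
      change σ ∈ biCone _ _ _
      revert hσ
      simp only [mem_biCone, LowerSet.notMem_bot, and_false, false_or, LowerSet.mem_inf_iff]
      tauto
    · simp [mem_biCone, toLeft_empty, hA0, hB0]
    · intro σ
      simp only [mem_biCone, LowerSet.notMem_bot, and_false, false_or,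
        Finset.toLeft_insert_inr, mem_insert, mem_erase, LowerSet.mem_inf_iff,
        toLeft_erase_inr]
      simp
      tauto
  obtain ⟨e5⟩ := realization_biCone_homeomorph (A ⊓ B) ⟨hA0, hB0⟩
  exact ⟨e0.some.toHomotopyEquiv.symm.trans (e1.some.symm.trans (e2.some.symm.trans
    (e3.some.trans (e4.some.trans e5.toHomotopyEquiv))))⟩

end
-- Noncovers of edge families and deletion of edges
/-- The vertex sets that avoid `S` and at least one of the edges in `H`. -/
def avoiding {V : Type*} (S : Set V) (H : Set (Set V)) : SimplicialComplex V where
  carrier := {W | (∀ v ∈ W, v ∉ S) ∧ ∃ e ∈ H, ∀ v ∈ W, v ∉ e}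
  lower' := fun _ _ h ⟨h1, e, he, h2⟩ =>
    ⟨fun v hv => h1 v (h hv), e, he, fun v hv => h2 v (h hv)⟩

theorem mem_avoiding {V : Type*} {S : Set V} {H : Set (Set V)} {W : Finset V} :
    W ∈ avoiding S H ↔ (∀ v ∈ W, v ∉ S) ∧ ∃ e ∈ H, ∀ v ∈ W, v ∉ e := Iff.rfl

/-- Deleting a set `D` of edges that avoid `p`, when every remaining edge through `p` contains,
up to any given edge of `D`, a remaining edge that avoids `p`. -/
theorem homotopyEquiv_of_deleteEdges {V : Type*} [Fintype V] [DecidableEq V] {H D : Set (Set V)}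
    (hH : H.Nonempty) (p : V) (hD : ∀ e ∈ D, p ∉ e)
    (h : ∀ e ∈ D, ∀ f ∈ H, p ∈ f → ∃ f' ∈ H, p ∉ f' ∧ f' ⊆ f ∪ e) :
    Nonempty (realization (avoiding ∅ (H ∪ D)) ≃ₕ realization (avoiding ∅ H)) := by
  refine homotopyEquiv_of_collapse ?_ ?_ p ?_
  · rintro W ⟨h1, e, he, h2⟩
    exact ⟨h1, e, Or.inl he, h2⟩
  · obtain ⟨e, he⟩ := hH
    exact ⟨by simp, e, he, by simp⟩
  · rintro W ⟨-, e, he | he, h2⟩ hW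
    · exact absurd ⟨by simp, e, he, h2⟩ hW
    refine ⟨⟨by simp, e, Or.inr he, fun v hv => ?_⟩, ?_⟩
    · rcases mem_insert.1 hv with rfl | hv
      · exact hD e he
      · exact h2 v hv
    · rintro ⟨-, f, hf, hWf⟩
      by_cases hp : p ∈ f
      · obtain ⟨f', hf', hp', hsub⟩ := h e he f hf hp
        refine hW ⟨by simp, f', hf', fun v hv hvf' => ?_⟩
        rcases hsub hvf' with h3 | h3
        · exact hWf v (mem_erase.2 ⟨fun h4 => hp' (h4 ▸ hvf'), hv⟩) h3
        · exact h2 v hv h3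
      · refine hW ⟨by simp, f, hf, fun v hv hvf => ?_⟩
        exact hWf v (mem_erase.2 ⟨fun h4 => hp (h4 ▸ hvf), hv⟩) hvf

/-- The arc of `k` vertices from `s` in the `n`-cycle, inside `Fin N`. -/
def arc (N n k s : ℕ) : Set (Fin N) :=
  {v | (v : ℕ) < n ∧ ((s ≤ v ∧ (v : ℕ) < s + k) ∨ (v : ℕ) + n < s + k)}

theorem mem_arc {N n k s : ℕ} {v : Fin N} : v ∈ arc N n k s ↔
    (v : ℕ) < n ∧ ((s ≤ v ∧ (v : ℕ) < s + k) ∨ (v : ℕ) + n < s + k) := Iff.rfl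

/-- The noncover complex of the tight cycle without the edges that start before `j`. -/
def cycleComplex (n k j : ℕ) : SimplicialComplex (Fin n) :=
  avoiding ∅ {e | ∃ s, j ≤ s ∧ s < n ∧ e = arc n n k s}

/-! ### Periodicity: from `n` to `n + k + 1` vertices -/

section Recursion
variable {n k j : ℕ}

/-- The edges of the tight `n`-cycle from position `c` on, inside `Fin (n + k + 1)`. -/
def innerEdges (n k j c : ℕ) : Set (Set (Fin (n + k + 1))) :=
  {e | ∃ s, j ≤ s ∧ c ≤ s ∧ s < n ∧ e = arc (n + k + 1) n k s}

/-- The edges of the tight `(n + k + 1)`-cycle that start at `j ≤ s < c`. -/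
def outerEdges (n k j c : ℕ) : Set (Set (Fin (n + k + 1))) :=
  {e | ∃ s, j ≤ s ∧ s < c ∧ e = arc (n + k + 1) (n + k + 1) k s}

/-- The short edge `e` at `c` wraps around at `n`; the pivot is `c + k`. A long edge through the
pivot starts at some `s` with `c < s ≤ c + k`. If `s ≤ n`, it and `e` together cover the long edge
at `c`, which ends just before the pivot; otherwise they cover the long edge at `c + k + 1`, which
starts just after it. -/
theorem addInnerEdges_step (hn : k < n) (hj : j < k) {c : ℕ} (hc : n < c + k)
    (hcn : c < n) :
    Nonempty (realization (avoiding ∅ (outerEdges n k j (n + k + 1) ∪ innerEdges n k j c)) ≃ₕ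
      realization (avoiding ∅ (outerEdges n k j (n + k + 1) ∪ innerEdges n k j (c + 1)))) := by
  by_cases hjc : j ≤ c
  · have : outerEdges n k j (n + k + 1) ∪ innerEdges n k j c =
        (outerEdges n k j (n + k + 1) ∪ innerEdges n k j (c + 1)) ∪ {arc (n + k + 1) n k c} := by
      rw [Set.union_assoc]
      congr 1
      ext e
      constructor
      · rintro ⟨s, h1, h2, h3, rfl⟩
        rcases h2.eq_or_lt with rfl | h2
        · right; rfl
        · left; exact ⟨s, h1, h2, h3, rfl⟩
      · rintro (⟨s, h1, h2, h3, rfl⟩ | rfl)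
        · exact ⟨s, h1, by omega, h3, rfl⟩
        · exact ⟨c, hjc, le_rfl, hcn, rfl⟩
    rw [this]
    refine homotopyEquiv_of_deleteEdges ⟨_, Or.inl ⟨n, by omega, by omega, rfl⟩⟩
      ⟨c + k, by omega⟩ ?_ ?_
    · rintro e rfl
      simp only [mem_arc]
      omega
    · rintro e rfl f (⟨s, h1, h2, rfl⟩ | ⟨s, h1, h2, h3, rfl⟩) hp
      · simp only [mem_arc] at hp
        by_cases hs : s ≤ n
        · refine ⟨_, Or.inl ⟨c, hjc, by omega, rfl⟩, ?_, ?_⟩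
          · simp only [mem_arc]; omega
          · intro v hv
            simp only [Set.mem_union, mem_arc] at hv ⊢
            omega
        · refine ⟨_, Or.inl ⟨c + k + 1, by omega, by omega, rfl⟩, ?_, ?_⟩
          · simp only [mem_arc]; omega
          · intro v hv
            simp only [Set.mem_union, mem_arc] at hv ⊢
            omega
      · simp only [mem_arc] at hp
        omega
  · have : innerEdges n k j c = innerEdges n k j (c + 1) := by
      ext e
      constructor
      · rintro ⟨s, h1, h2, h3, rfl⟩
        exact ⟨s, h1, by omega, h3, rfl⟩
      · rintro ⟨s, h1, h2, h3, rfl⟩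
        exact ⟨s, h1, by omega, h3, rfl⟩
    rw [this]
    exact ⟨.refl _⟩

theorem addInnerEdges (hn : k < n) (hj : j < k) {i : ℕ} (hi : i < k) :
    Nonempty (realization (avoiding ∅ (outerEdges n k j (n + k + 1) ∪ innerEdges n k j (n - i))) ≃ₕ
      realization (avoiding ∅ (outerEdges n k j (n + k + 1) ∪ innerEdges n k j n))) := by
  induction i with
  | zero => exact ⟨.refl _⟩
  | succ i ih =>
    obtain ⟨e1⟩ := ih (by omega)
    obtain ⟨e2⟩ := addInnerEdges_step hn hj (c := n - (i + 1)) (by omega) (by omega)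
    rw [show n - (i + 1) + 1 = n - i by omega] at e2
    exact ⟨e2.trans e1⟩

/-- With pivot `n`, let `s` be the start of a deleted edge and `s'` that of a remaining edge through
`n`. If `s ≤ s' + k`, the two cover the long edge at `n + 1`; otherwise a gap remains beyond `n`,
but they cover the wrapping short edge at `s - (k + 1)`. This is why the wrapping short edges are
added beforehand. -/
theorem removeRightEdges (hk : 0 < k) (hn : k < n) (hj : j < k) :
    Nonempty (realization (avoiding ∅
        (outerEdges n k j (n + k + 1) ∪ innerEdges n k j (n - (k - 1)))) ≃ₕ
      realization (avoiding ∅ (outerEdges n k j (n + 2) ∪ innerEdges n k j (n - (k - 1))))) := by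
  have : outerEdges n k j (n + k + 1) ∪ innerEdges n k j (n - (k - 1)) =
      (outerEdges n k j (n + 2) ∪ innerEdges n k j (n - (k - 1))) ∪
        {e | ∃ s, n + 2 ≤ s ∧ s < n + k + 1 ∧ e = arc (n + k + 1) (n + k + 1) k s} := by
    ext e
    constructor
    · rintro (⟨s, h1, h2, rfl⟩ | h)
      · by_cases hs : s < n + 2
        · exact Or.inl (Or.inl ⟨s, h1, hs, rfl⟩)
        · exact Or.inr ⟨s, by omega, h2, rfl⟩
      · exact Or.inl (Or.inr h)
    · rintro ((⟨s, h1, h2, rfl⟩ | h) | ⟨s, h1, h2, rfl⟩)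
      · exact Or.inl ⟨s, h1, by omega, rfl⟩
      · exact Or.inr h
      · exact Or.inl ⟨s, by omega, h2, rfl⟩
  rw [this]
  refine homotopyEquiv_of_deleteEdges ⟨_, Or.inl ⟨n, by omega, by omega, rfl⟩⟩
    ⟨n, by omega⟩ ?_ ?_
  · rintro e ⟨s, h1, h2, rfl⟩
    simp only [mem_arc]
    omega
  · rintro e ⟨s, h1, h2, rfl⟩ f (⟨s', h1', h2', rfl⟩ | ⟨s', h1', h2', h3', rfl⟩) hp
    · simp only [mem_arc] at hp
      by_cases hs : s ≤ s' + k
      · refine ⟨_, Or.inl ⟨n + 1, by omega, by omega, rfl⟩, ?_, ?_⟩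
        · simp only [mem_arc]; omega
        · intro v hv
          simp only [Set.mem_union, mem_arc] at hv ⊢
          omega
      · refine ⟨_, Or.inr ⟨s - (k + 1), by omega, by omega, by omega, rfl⟩, ?_, ?_⟩
        · simp only [mem_arc]; omega
        · intro v hv
          simp only [Set.mem_union, mem_arc] at hv ⊢
          omega
    · simp only [mem_arc] at hp
      omega

/-- With pivot `n + k`, the only remaining edge through the pivot is the long edge at `n + 1`. Each
deleted edge contains `n`, so together they cover the long edge at `n`. -/
theorem removeLeftEdges (hk : 0 < k) (hn : k < n) (hj : j < k) :
    Nonempty (realization (avoiding ∅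
        (outerEdges n k j (n + 2) ∪ innerEdges n k j (n - (k - 1)))) ≃ₕ
      realization (avoiding ∅
        (outerEdges n k n (n + 2) ∪ innerEdges n k j 0))) := by
  have : outerEdges n k j (n + 2) ∪ innerEdges n k j (n - (k - 1)) =
      (outerEdges n k n (n + 2) ∪ innerEdges n k j 0) ∪
        {e | ∃ s, j ≤ s ∧ n < s + k ∧ s < n ∧ e = arc (n + k + 1) (n + k + 1) k s} := by
    -- Edges that stay below `n` are the same in both cycles, so they survive as short edges.
    have hio : ∀ s, s + k ≤ n → arc (n + k + 1) (n + k + 1) k s = arc (n + k + 1) n k s := by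
      intro s hs
      ext v
      simp only [mem_arc]
      omega
    ext e
    constructor
    · rintro (⟨s, h1, h2, rfl⟩ | ⟨s, h1, h2, h3, rfl⟩)
      · by_cases hs : n ≤ s
        · exact Or.inl (Or.inl ⟨s, hs, h2, rfl⟩)
        by_cases hs : s + k ≤ n
        · exact Or.inl (Or.inr ⟨s, h1, by omega, by omega, hio s hs⟩)
        · exact Or.inr ⟨s, h1, by omega, by omega, rfl⟩
      · exact Or.inl (Or.inr ⟨s, h1, by omega, h3, rfl⟩)
    · rintro ((⟨s, h1, h2, rfl⟩ | ⟨s, h1, h2, h3, rfl⟩) | ⟨s, h1, h2, h3, rfl⟩)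
      · exact Or.inl ⟨s, by omega, by omega, rfl⟩
      · by_cases hs : s + k ≤ n
        · exact Or.inl ⟨s, h1, by omega, (hio s hs).symm⟩
        · exact Or.inr ⟨s, h1, by omega, h3, rfl⟩
      · exact Or.inl ⟨s, h1, by omega, rfl⟩
  rw [this]
  refine homotopyEquiv_of_deleteEdges ⟨_, Or.inl ⟨n, by omega, by omega, rfl⟩⟩
    ⟨n + k, by omega⟩ ?_ ?_
  · rintro e ⟨s, h1, h2, h3, rfl⟩
    simp only [mem_arc]
    omega
  · rintro e ⟨s, h1, h2, h3, rfl⟩ f (⟨s', h1', h2', rfl⟩ | ⟨s', h1', h2', h3', rfl⟩) hp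
    · simp only [mem_arc] at hp
      refine ⟨_, Or.inl ⟨n, by omega, by omega, rfl⟩, ?_, ?_⟩
      · simp only [mem_arc]; omega
      · intro v hv
        simp only [Set.mem_union, mem_arc] at hv ⊢
        omega
    · simp only [mem_arc] at hp
      omega

/-- The vertices strictly between `n` and `n + k`. -/
def middle (n k : ℕ) : Set (Fin (n + k + 1)) := {v | n < (v : ℕ) ∧ (v : ℕ) < n + k}

/-- A middle vertex lies in both long edges, so a face containing one must miss a short edge. Short
edges do not contain `n`, so such faces can be toggled at `n`. -/
theorem removeMiddle (hk : 0 < k) :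
    Nonempty (realization (avoiding ∅ (outerEdges n k n (n + 2) ∪ innerEdges n k j 0)) ≃ₕ
      realization (avoiding (middle n k) (outerEdges n k n (n + 2) ∪ innerEdges n k j 0))) := by
  refine homotopyEquiv_of_collapse ?_ ?_ ⟨n, by omega⟩ ?_
  · rintro W ⟨-, e, he, h2⟩
    exact ⟨by simp, e, he, h2⟩
  · exact ⟨by simp, _, Or.inl ⟨n, by omega, by omega, rfl⟩, by simp⟩
  · rintro W ⟨-, e, he, h2⟩ hW
    have hm : ∃ v ∈ W, v ∈ middle n k := by
      by_contra hcon
      push Not at hcon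
      exact hW ⟨hcon, e, he, h2⟩
    obtain ⟨v, hv, hvm⟩ := hm
    refine ⟨⟨by simp, e, he, fun u hu => ?_⟩, ?_⟩
    · rcases mem_insert.1 hu with rfl | hu
      · have := h2 v hv
        rcases he with ⟨s, h1', h2', rfl⟩ | ⟨s, h1', h2', h3', rfl⟩
        · simp only [mem_arc, middle, Set.mem_ofPred_eq] at this hvm ⊢
          omega
        · simp only [mem_arc] at this hvm ⊢
          omega
      · exact h2 u hu
    · rintro ⟨h3, -⟩
      refine h3 v (mem_erase.2 ⟨?_, hv⟩) hvm
      rintro rfl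
      simp [middle] at hvm

theorem not_mem_innerEdge {c : ℕ} {e : Set (Fin (n + k + 1))} (he : e ∈ innerEdges n k j c)
    {v : Fin (n + k + 1)} (hv : n ≤ v) : v ∉ e := by
  obtain ⟨s, h1, h2, h3, rfl⟩ := he
  simp only [mem_arc]
  omega

/-- Without the middle vertices the two long edges amount to `{n}` and `{n + k}`. The sets missing
`n` form a cone with apex `0`; the sets missing `n + k` or a short edge form a cone with apex `n`,
which lies in none of those edges. -/
theorem middle_homotopyEquiv_susp (hk : 0 < k) (hn : k < n) :
    Nonempty (realization (avoiding (middle n k)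
        (outerEdges n k n (n + 2) ∪ innerEdges n k j 0)) ≃ₕ
      susp (realization (avoiding (middle n k ∪ {⟨n, by omega⟩})
        ({{⟨n + k, by omega⟩}} ∪ innerEdges n k j 0)))) := by
  set x : Fin (n + k + 1) := ⟨n, by omega⟩ with hx
  set y : Fin (n + k + 1) := ⟨n + k, by omega⟩ with hy
  have hA : IsCone (avoiding (middle n k) {{x}}) ⟨0, by omega⟩ := by
    have h0 : (⟨0, by omega⟩ : Fin (n + k + 1)) ≠ x := by simp [hx, Fin.ext_iff]; omega
    refine ⟨⟨?_, {x}, rfl, by simpa using h0⟩, ?_⟩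
    · simp [middle]
    · rintro W ⟨h1, e, rfl, h2⟩
      refine ⟨fun v hv => ?_, {x}, rfl, fun v hv => ?_⟩
      · rcases mem_insert.1 hv with rfl | hv
        · simp [middle]
        · exact h1 v hv
      · rcases mem_insert.1 hv with rfl | hv
        · exact h0
        · exact h2 v hv
  have hB : IsCone (avoiding (middle n k) ({{y}} ∪ innerEdges n k j 0)) x := by
    have h0 : x ≠ y := by simp [hx, hy, Fin.ext_iff]; omega
    refine ⟨⟨?_, {y}, Or.inl rfl, by simpa using h0⟩, ?_⟩
    · simp [middle, hx]
    · rintro W ⟨h1, e, he, h2⟩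
      refine ⟨fun v hv => ?_, e, he, fun v hv => ?_⟩
      · rcases mem_insert.1 hv with rfl | hv
        · simp [middle, hx]
        · exact h1 v hv
      · rcases mem_insert.1 hv with rfl | hv
        · rcases he with rfl | he
          · exact h0
          · exact not_mem_innerEdge he (by simp [hx])
        · exact h2 v hv
  have hsup : avoiding (middle n k) (outerEdges n k n (n + 2) ∪ innerEdges n k j 0) =
      avoiding (middle n k) {{x}} ⊔ avoiding (middle n k) ({{y}} ∪ innerEdges n k j 0) := by
    ext W
    simp only [mem_avoiding, LowerSet.mem_sup_iff, SetLike.mem_coe]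
    rw [← and_or_left]
    refine and_congr_right fun hm => ?_
    constructor
    · rintro ⟨e, ⟨s, h1, h2, rfl⟩ | he, h⟩
      · rcases (by omega : s = n ∨ s = n + 1) with rfl | rfl
        · left
          refine ⟨_, rfl, fun v hv hvx => h v hv ?_⟩
          rw [Set.mem_singleton_iff] at hvx
          simp only [mem_arc, hvx, hx]
          omega
        · right
          refine ⟨_, Or.inl rfl, fun v hv hvx => h v hv ?_⟩
          rw [Set.mem_singleton_iff] at hvx
          simp only [mem_arc, hvx, hy]
          omega
      · exact Or.inr ⟨e, Or.inr he, h⟩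
    · rintro (⟨_, rfl, h⟩ | ⟨e, rfl | he, h⟩)
      · refine ⟨_, Or.inl ⟨n, by omega, by omega, rfl⟩, fun v hv hva => ?_⟩
        have h1 := h v hv
        have h2 := hm v hv
        simp only [Set.mem_singleton_iff, hx, Fin.ext_iff] at h1
        simp only [middle, Set.mem_ofPred_eq] at h2
        simp only [mem_arc] at hva
        omega
      · refine ⟨_, Or.inl ⟨n + 1, by omega, by omega, rfl⟩, fun v hv hva => ?_⟩
        have h1 := h v hv
        have h2 := hm v hv
        simp only [Set.mem_singleton_iff, hy, Fin.ext_iff] at h1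
        simp only [middle, Set.mem_ofPred_eq] at h2
        simp only [mem_arc] at hva
        omega
      · exact ⟨e, Or.inr he, h⟩
  have hinf : avoiding (middle n k ∪ {x}) ({{y}} ∪ innerEdges n k j 0) =
      avoiding (middle n k) {{x}} ⊓ avoiding (middle n k) ({{y}} ∪ innerEdges n k j 0) := by
    ext W
    simp only [LowerSet.mem_inf_iff, SetLike.mem_coe, mem_avoiding, Set.mem_union,
      not_or]
    constructor
    · rintro ⟨h1, e, he, h⟩
      exact ⟨⟨fun v hv => (h1 v hv).1, {x}, rfl, fun v hv => (h1 v hv).2⟩,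
        fun v hv => (h1 v hv).1, e, he, h⟩
    · rintro ⟨⟨h1, _, rfl, h2⟩, -, e, he, h⟩
      exact ⟨fun v hv => ⟨h1 v hv, h2 v hv⟩, e, he, h⟩
  rw [hsup, hinf]
  exact hA.sup_homotopyEquiv_susp hB

/-- The same decomposition at `n + k`; the intersection of the two cones lives on the vertices below
`n`. -/
theorem middleLeft_homotopyEquiv_susp (hn : k < n) (hj : j < k) :
    Nonempty (realization (avoiding (middle n k ∪ {⟨n, by omega⟩})
        ({{⟨n + k, by omega⟩}} ∪ innerEdges n k j 0)) ≃ₕ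
      susp (realization (avoiding {v : Fin (n + k + 1) | n ≤ (v : ℕ)} (innerEdges n k j 0)))) := by
  set x : Fin (n + k + 1) := ⟨n, by omega⟩ with hx
  set y : Fin (n + k + 1) := ⟨n + k, by omega⟩ with hy
  have hS : ∀ v : Fin (n + k + 1), v ∈ middle n k ∪ {x} ↔ n ≤ (v : ℕ) ∧ (v : ℕ) < n + k := by
    intro v
    simp only [middle, Set.mem_union, Set.mem_ofPred_eq, Set.mem_singleton_iff, hx, Fin.ext_iff]
    omega
  have hA : IsCone (avoiding (middle n k ∪ {x}) {{y}}) ⟨0, by omega⟩ := by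
    have h0 : (⟨0, by omega⟩ : Fin (n + k + 1)) ≠ y := by simp [hy, Fin.ext_iff]; omega
    have h0' : (⟨0, by omega⟩ : Fin (n + k + 1)) ∉ middle n k ∪ {x} := by
      rw [hS]; simp only; omega
    refine ⟨⟨by simpa using h0', {y}, rfl, by simpa using h0⟩, ?_⟩
    rintro W ⟨h1, e, rfl, h2⟩
    refine ⟨fun v hv => ?_, {y}, rfl, fun v hv => ?_⟩
    · rcases mem_insert.1 hv with rfl | hv
      · exact h0'
      · exact h1 v hv
    · rcases mem_insert.1 hv with rfl | hv
      · exact h0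
      · exact h2 v hv
  have hB : IsCone (avoiding (middle n k ∪ {x}) (innerEdges n k j 0)) y := by
    have h0' : y ∉ middle n k ∪ {x} := by
      rw [hS]; simp [hy]
    refine ⟨⟨by simpa using h0', _, ⟨j, le_rfl, by omega, by omega, rfl⟩, ?_⟩, ?_⟩
    · intro v hv
      rw [mem_singleton] at hv
      simp only [hv, mem_arc, hy]
      omega
    · rintro W ⟨h1, e, he, h2⟩
      refine ⟨fun v hv => ?_, e, he, fun v hv => ?_⟩
      · rcases mem_insert.1 hv with rfl | hv
        · exact h0'
        · exact h1 v hv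
      · rcases mem_insert.1 hv with rfl | hv
        · exact not_mem_innerEdge he (by simp [hy])
        · exact h2 v hv
  have hsup : avoiding (middle n k ∪ {x}) ({{y}} ∪ innerEdges n k j 0) =
      avoiding (middle n k ∪ {x}) {{y}} ⊔ avoiding (middle n k ∪ {x}) (innerEdges n k j 0) := by
    ext W
    simp only [mem_avoiding, LowerSet.mem_sup_iff, SetLike.mem_coe]
    rw [← and_or_left]
    refine and_congr_right fun hm => ?_
    simp [or_and_right, exists_or]
  have hinf : avoiding {v : Fin (n + k + 1) | n ≤ (v : ℕ)} (innerEdges n k j 0) =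
      avoiding (middle n k ∪ {x}) {{y}} ⊓ avoiding (middle n k ∪ {x}) (innerEdges n k j 0) := by
    ext W
    simp only [LowerSet.mem_inf_iff, SetLike.mem_coe, mem_avoiding, hS, Set.mem_ofPred_eq]
    constructor
    · rintro ⟨h1, e, he, h⟩
      have h2 : ∀ v ∈ W, ¬(n ≤ (v : ℕ) ∧ (v : ℕ) < n + k) := fun v hv h3 => h1 v hv h3.1
      refine ⟨⟨h2, {y}, rfl, fun v hv hvy => h1 v hv ?_⟩, h2, e, he, h⟩
      rw [Set.mem_singleton_iff] at hvy
      simp [hvy, hy]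
    · rintro ⟨⟨h1, _, rfl, h2⟩, -, e, he, h⟩
      refine ⟨fun v hv hle => ?_, e, he, h⟩
      have h3 := h1 v hv
      have h4 := h2 v hv
      simp only [Set.mem_singleton_iff, hy, Fin.ext_iff] at h4
      omega
  rw [hsup, hinf]
  exact hA.sup_homotopyEquiv_susp hB

theorem inner_homeomorph (n k j : ℕ) :
    Nonempty (realization (avoiding {v : Fin (n + k + 1) | n ≤ (v : ℕ)} (innerEdges n k j 0)) ≃ₜ
      realization (cycleComplex n k j)) := by
  refine homeomorph_of_relabel (Fin.castLEEmb (by omega)) (fun W => ?_) (fun W hW v hv => ?_)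
  · simp only [cycleComplex, mem_avoiding, innerEdges]
    constructor
    · rintro ⟨-, _, ⟨s, h1, h2, rfl⟩, h⟩
      refine ⟨by simp, _, ⟨s, h1, by omega, h2, rfl⟩, ?_⟩
      simp only [mem_map, forall_exists_index, and_imp, forall_apply_eq_imp_iff₂]
      intro v hv hva
      exact h v hv hva
    · rintro ⟨-, _, ⟨s, h1, -, h2, rfl⟩, h⟩
      refine ⟨by simp, _, ⟨s, h1, h2, rfl⟩, fun v hv hva => ?_⟩
      exact h _ (mem_map_of_mem _ hv) hva
  · have := hW.1 v hv
    simp only [Set.mem_ofPred_eq, not_le] at this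
    exact ⟨⟨v, this⟩, rfl⟩

/-- Enlarging the cycle by `k + 1` vertices suspends the noncover complex twice. -/
theorem cycleComplex_homotopyEquiv_susp_susp (hn : k < n) (hj : j < k) :
    Nonempty (realization (cycleComplex (n + k + 1) k j) ≃ₕ
      susp (susp (realization (cycleComplex n k j)))) := by
  have hk : 0 < k := by omega
  have e0 : cycleComplex (n + k + 1) k j =
      avoiding ∅ (outerEdges n k j (n + k + 1) ∪ innerEdges n k j n) := by
    unfold cycleComplex
    congr 1
    ext e
    constructor
    · rintro ⟨s, h1, h2, rfl⟩
      exact Or.inl ⟨s, h1, h2, rfl⟩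
    · rintro (⟨s, h1, h2, rfl⟩ | ⟨s, h1, h2, h3, rfl⟩)
      · exact ⟨s, h1, h2, rfl⟩
      · omega
  obtain ⟨e1⟩ := addInnerEdges hn hj (i := k - 1) (by omega)
  obtain ⟨e2⟩ := removeRightEdges hk hn hj
  obtain ⟨e3⟩ := removeLeftEdges hk hn hj
  obtain ⟨e4⟩ := removeMiddle (n := n) (j := j) hk
  obtain ⟨e5⟩ := middle_homotopyEquiv_susp (j := j) hk hn
  obtain ⟨e6⟩ := middleLeft_homotopyEquiv_susp hn hj
  obtain ⟨e7⟩ := inner_homeomorph n k j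
  obtain ⟨e8⟩ := susp_homotopyEquiv (isBounded_realization _) (isBounded_realization _)
    ⟨e7.toHomotopyEquiv⟩
  obtain ⟨e9⟩ := susp_homotopyEquiv (isBounded_realization _)
    (isBounded_susp (isBounded_realization _)) ⟨e6.trans e8⟩
  rw [e0]
  exact ⟨e1.symm.trans (e2.trans (e3.trans (e4.trans (e5.trans e9))))⟩

end Recursion

/-! ### Base cases: complexes of arcs -/

section Base

/-- The complex generated by `[0, c]` and the arcs `[a, a + t]` with `a < N` in the `n`-cycle. -/
def arcComplex (n t N c : ℕ) : SimplicialComplex (Fin n) where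
  carrier := {W | (∀ v ∈ W, (v : ℕ) ≤ c) ∨
    ∃ a < N, ∀ v ∈ W, (a ≤ (v : ℕ) ∧ (v : ℕ) ≤ a + t) ∨ (v : ℕ) + n ≤ a + t}
  lower' := fun _ _ h hW => hW.imp (fun h1 v hv => h1 v (h hv))
    fun ⟨a, ha, h1⟩ => ⟨a, ha, fun v hv => h1 v (h hv)⟩

theorem mem_arcComplex {n t N c : ℕ} {W : Finset (Fin n)} : W ∈ arcComplex n t N c ↔
    (∀ v ∈ W, (v : ℕ) ≤ c) ∨
    ∃ a < N, ∀ v ∈ W, (a ≤ (v : ℕ) ∧ (v : ℕ) ≤ a + t) ∨ (v : ℕ) + n ≤ a + t := Iff.rfl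

theorem arcComplex_step {n t N c : ℕ} (ht : 1 ≤ t) (hN : N ≤ n) (hc : t ≤ c) (hcn : c + 1 + t < n) :
    Nonempty (realization (arcComplex n t N (c + 1)) ≃ₕ realization (arcComplex n t N c)) := by
  refine homotopyEquiv_of_collapse ?_ ?_ ⟨c, by omega⟩ ?_
  · rintro W (h | h)
    · exact Or.inl fun v hv => (h v hv).trans (by omega)
    · exact Or.inr h
  · exact Or.inl (by simp)
  · rintro W (h | h) hW
    · refine ⟨Or.inl fun v hv => ?_, ?_⟩
      · rcases mem_insert.1 hv with rfl | hv
        · simp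
        · exact h v hv
      · intro hE
        apply hW
        by_cases hcW : ∃ v ∈ W, (v : ℕ) = c + 1
        · obtain ⟨u, hu, huc⟩ := hcW
          have hne : u ≠ ⟨c, by omega⟩ := by
            intro h'; rw [h'] at huc; simp at huc
          rcases hE with hE | ⟨a, ha, hE⟩
          · have := hE u (mem_erase.2 ⟨hne, hu⟩)
            omega
          · have hua := hE u (mem_erase.2 ⟨hne, hu⟩)
            right
            -- An arc containing `c + 1` starts at `a ≤ c + 1`. If `a ≤ c`, it already contains `c`;
            -- if `a = c + 1`, then `W ⊆ {c, c + 1}`, which fits in the arc from `c` because `1 ≤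
            -- t`.
            refine ⟨min a c, by omega, fun v hv => ?_⟩
            have hvc := h v hv
            by_cases hvc' : v = ⟨c, by omega⟩
            · simp only [hvc']
              omega
            · have := hE v (mem_erase.2 ⟨hvc', hv⟩)
              omega
        · push Not at hcW
          left
          intro v hv
          have := h v hv
          have := hcW v hv
          omega
    · exact absurd (Or.inr h) hW

theorem arcComplex_homotopyEquiv {n t N c d : ℕ} (ht : 1 ≤ t) (hN : N ≤ n) (hc : t ≤ c)
    (hcn : c + d + t < n) :
    Nonempty (realization (arcComplex n t N (c + d)) ≃ₕ realization (arcComplex n t N c)) := by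
  induction d with
  | zero => exact ⟨.refl _⟩
  | succ d ih =>
    obtain ⟨e1⟩ := ih (by omega)
    obtain ⟨e2⟩ := arcComplex_step (n := n) (N := N) ht hN (c := c + d) (by omega) (by omega)
    exact ⟨e2.trans e1⟩

/-- In the small case, the noncover complex is a complex of arcs, up to rotation. -/
theorem cycleComplex_homeomorph_arcComplex {k t j : ℕ} (hj : j < k) :
    Nonempty (realization (cycleComplex (k + 1 + t) k j) ≃ₜ
      realization (arcComplex (k + 1 + t) t (k + 1 + t - j) t)) := by
  -- Rotation by `j + k`: it carries the arc `[a, a + t]` to the complement of the edge starting at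
  -- `a + j`. The sum `v + j + k` may exceed the cycle length twice.
  let f : Fin (k + 1 + t) → Fin (k + 1 + t) := fun v =>
    ⟨if v + j + k < k + 1 + t then v + j + k else
      if v + j + k < 2 * (k + 1 + t) then v + j + k - (k + 1 + t)
        else v + j + k - 2 * (k + 1 + t), by
      have := v.2
      split_ifs <;> omega⟩
  have hfv : ∀ v, ((f v : ℕ) = v + j + k) ∨ ((f v : ℕ) + (k + 1 + t) = v + j + k) ∨
      ((f v : ℕ) + 2 * (k + 1 + t) = v + j + k) := by
    intro v
    have := v.2
    simp only [f]
    split_ifs <;> omega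
  have hinj : Function.Injective f := by
    intro v w h
    have h1 := hfv v
    have h2 := hfv w
    rw [h] at h1
    ext
    have := v.2
    have := w.2
    omega
  have hsurj : Function.Surjective f := Finite.surjective_of_injective hinj
  refine homeomorph_of_relabel ⟨f, hinj⟩ (fun W => ?_) (fun W hW v hv => hsurj v)
  simp only [cycleComplex, mem_avoiding, mem_arcComplex]
  have key : ∀ a < k + 1 + t - j, ∀ v : Fin (k + 1 + t),
      ((a ≤ (v : ℕ) ∧ (v : ℕ) ≤ a + t) ∨ (v : ℕ) + (k + 1 + t) ≤ a + t) ↔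
        f v ∉ arc (k + 1 + t) (k + 1 + t) k (a + j) := by
    intro a ha v
    have h1 := hfv v
    have := v.2
    have := (f v).2
    simp only [mem_arc]
    omega
  constructor
  · rintro (h | ⟨a, ha, h⟩)
    · refine ⟨by simp, _, ⟨0 + j, by omega, by omega, rfl⟩, ?_⟩
      simp only [mem_map, forall_exists_index, and_imp, forall_apply_eq_imp_iff₂]
      intro v hv
      exact (key 0 (by omega) v).1 (by have := h v hv; omega)
    · refine ⟨by simp, _, ⟨a + j, by omega, by omega, rfl⟩, ?_⟩
      simp only [mem_map, forall_exists_index, and_imp, forall_apply_eq_imp_iff₂]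
      intro v hv
      exact (key a ha v).1 (h v hv)
  · rintro ⟨-, _, ⟨s, h1, h2, rfl⟩, h⟩
    refine Or.inr ⟨s - j, by omega, fun v hv => ?_⟩
    rw [key (s - j) (by omega), show s - j + j = s by omega]
    exact h _ (mem_map_of_mem _ hv)

theorem cycleComplex_homotopyEquiv_arcComplex {k t j : ℕ} (hj : j < k) (ht : 1 ≤ t) (htk : t ≤ k) :
    Nonempty (realization (cycleComplex (k + 1 + t) k j) ≃ₕ
      realization (arcComplex (k + 1 + t) t (k + 1 + t - j) k)) := by
  obtain ⟨e1⟩ := cycleComplex_homeomorph_arcComplex (t := t) hj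
  obtain ⟨e2⟩ := arcComplex_homotopyEquiv (n := k + 1 + t) (N := k + 1 + t - j) (c := t)
    (d := k - t) ht (by omega) le_rfl (by omega)
  rw [show t + (k - t) = k by omega] at e2
  exact ⟨e1.toHomotopyEquiv.trans e2.symm⟩

/-- After fattening, vertex `k` is an apex: arcs ending before `k` lie in `[0, k]`, and all others
contain `k`, since `t ≤ j` forces every starting point `a` to be at most `k`. -/
theorem cycleComplex_contractible_of_le {k t j : ℕ} (hj : j < k) (ht : 1 ≤ t) (htj : t ≤ j) :
    ContractibleSpace (realization (cycleComplex (k + 1 + t) k j)) := by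
  have hcone : IsCone (arcComplex (k + 1 + t) t (k + 1 + t - j) k) ⟨k, by omega⟩ := by
    refine ⟨Or.inl (by simp), ?_⟩
    rintro W (h | ⟨a, ha, h⟩)
    · refine Or.inl fun v hv => ?_
      rcases mem_insert.1 hv with rfl | hv
      · simp
      · exact h v hv
    · by_cases hak : k ≤ a + t
      · refine Or.inr ⟨a, ha, fun v hv => ?_⟩
        rcases mem_insert.1 hv with rfl | hv
        · simp only; omega
        · exact h v hv
      · refine Or.inl fun v hv => ?_
        rcases mem_insert.1 hv with rfl | hv
        · simp
        · have := h v hv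
          omega
  have := hcone.contractibleSpace
  exact contractibleSpace_of_homotopyEquiv
    (cycleComplex_homotopyEquiv_arcComplex hj ht (by omega))

/-- The complex of all vertex sets in the interval `[a, b]`. -/
def intervalComplex (n a b : ℕ) : SimplicialComplex (Fin n) where
  carrier := {W | ∀ v ∈ W, a ≤ (v : ℕ) ∧ (v : ℕ) ≤ b}
  lower' := fun _ _ h hW v hv => hW v (h hv)

theorem mem_intervalComplex {n a b : ℕ} {W : Finset (Fin n)} :
    W ∈ intervalComplex n a b ↔ ∀ v ∈ W, a ≤ (v : ℕ) ∧ (v : ℕ) ≤ b := Iff.rfl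

theorem isCone_intervalComplex {n a b : ℕ} {p : Fin n} (h1 : a ≤ p) (h2 : p ≤ b) :
    IsCone (intervalComplex n a b) p := by
  refine ⟨by simpa [mem_intervalComplex] using ⟨h1, h2⟩, fun W hW v hv => ?_⟩
  rcases mem_insert.1 hv with rfl | hv
  · exact ⟨h1, h2⟩
  · exact hW v hv

/-- The arcs starting after `k` all wrap around and contain `0`, while the rest, with `[0, k]`, form
a cone with apex `k`. These cones meet in two disjoint simplices, and that pair is in turn the
suspension of the empty set. -/
theorem cycleComplex_homotopyEquiv_susp_empty {k t j : ℕ} (hj : j < k) (hjt : j < t)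
    (htk : t ≤ k) :
    Nonempty (realization (cycleComplex (k + 1 + t) k j) ≃ₕ
      susp (susp (∅ : Set (Fin (k + 1 + t) → ℝ)))) := by
  set n := k + 1 + t with hn
  let A : SimplicialComplex (Fin n) := arcComplex n t (k + 1) k
  let B : SimplicialComplex (Fin n) :=
    { carrier := {W | ∃ a, k < a ∧ a < n - j ∧
        ∀ v ∈ W, (a ≤ (v : ℕ) ∧ (v : ℕ) ≤ a + t) ∨ (v : ℕ) + n ≤ a + t}
      lower' := fun _ _ h ⟨a, h1, h2, hW⟩ => ⟨a, h1, h2, fun v hv => hW v (h hv)⟩ }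
  have hA : IsCone A ⟨k, by omega⟩ := by
    refine ⟨Or.inl (by simp), ?_⟩
    rintro W (h | ⟨a, ha, h⟩)
    · refine Or.inl fun v hv => ?_
      rcases mem_insert.1 hv with rfl | hv
      · simp
      · exact h v hv
    · by_cases hak : k ≤ a + t
      · refine Or.inr ⟨a, ha, fun v hv => ?_⟩
        rcases mem_insert.1 hv with rfl | hv
        · simp only; omega
        · exact h v hv
      · refine Or.inl fun v hv => ?_
        rcases mem_insert.1 hv with rfl | hv
        · simp
        · have := h v hv
          omega
  have hB : IsCone B ⟨0, by omega⟩ := by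
    refine ⟨⟨k + 1, by omega, by omega, fun v hv => ?_⟩, ?_⟩
    · rw [mem_singleton] at hv
      rw [hv]
      simp only; omega
    · rintro W ⟨a, h1, h2, h⟩
      refine ⟨a, h1, h2, fun v hv => ?_⟩
      rcases mem_insert.1 hv with rfl | hv
      · simp only; omega
      · exact h v hv
  have hAB : A ⊔ B = arcComplex n t (n - j) k := by
    ext W
    simp only [SetLike.mem_coe, LowerSet.mem_sup_iff]
    constructor
    · rintro ((h | ⟨a, ha, h⟩) | ⟨a, h1, h2, h⟩)
      · exact Or.inl h
      · exact Or.inr ⟨a, by omega, h⟩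
      · exact Or.inr ⟨a, h2, h⟩
    · rintro (h | ⟨a, ha, h⟩)
      · exact Or.inl (Or.inl h)
      · by_cases hak : a < k + 1
        · exact Or.inl (Or.inr ⟨a, hak, h⟩)
        · exact Or.inr ⟨a, by omega, ha, h⟩
  have hI : A ⊓ B = intervalComplex n (k + 1) (k + t) ⊔ intervalComplex n 0 (t - 1 - j) := by
    ext W
    simp only [SetLike.mem_coe, LowerSet.mem_sup_iff, LowerSet.mem_inf_iff]
    constructor
    · rintro ⟨hWA, a, h1, h2, h⟩
      by_cases hlow : ∃ u ∈ W, (u : ℕ) ≤ t - 1 - j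
      · obtain ⟨u, hu, hul⟩ := hlow
        right
        intro v hv
        have hua := h u hu
        have hva := h v hv
        have := v.2
        rcases hWA with hWA | ⟨b, hb, hWA⟩
        · have := hWA v hv
          omega
        · have := hWA u hu
          have := hWA v hv
          omega
      · push Not at hlow
        left
        intro v hv
        have := hlow v hv
        have := h v hv
        have := v.2
        omega
    · rintro (h | h)
      -- The interval `[k + 1, k + t]` lies in the arcs from `k` and `k + 1`; the interval `[0, t -
      -- 1 - j]` is the wrapped part of the last arc, which starts at `n - j - 1`.
      · refine ⟨Or.inr ⟨k, by omega, fun v hv => ?_⟩, k + 1, by omega, by omega, fun v hv => ?_⟩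
        · have := h v hv; omega
        · have := h v hv; omega
      · refine ⟨Or.inl fun v hv => ?_, n - j - 1, by omega, by omega, fun v hv => ?_⟩
        · have := h v hv; omega
        · have := h v hv; omega
  have hE : realization (intervalComplex n (k + 1) (k + t) ⊓ intervalComplex n 0 (t - 1 - j)) =
      ∅ := by
    rw [Set.eq_empty_iff_forall_notMem]
    rintro x ⟨hx, σ, ⟨hσ1, hσ2⟩, h⟩
    have hσ : σ = ∅ := by
      rw [Finset.eq_empty_iff_forall_notMem]
      intro v hv
      have := hσ1 v hv
      have := hσ2 v hv
      omega
    have : ∑ v, x v = 0 := Finset.sum_eq_zero fun v _ => h v (by simp [hσ])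
    rw [hx.2] at this
    exact one_ne_zero this
  obtain ⟨e1⟩ := cycleComplex_homotopyEquiv_arcComplex hj (by omega) htk
  obtain ⟨e2⟩ := hA.sup_homotopyEquiv_susp hB
  obtain ⟨e3⟩ := (isCone_intervalComplex (n := n) (a := k + 1) (b := k + t)
    (p := ⟨k + t, by omega⟩) (by simp; omega) (by simp)).sup_homotopyEquiv_susp
    (isCone_intervalComplex (n := n) (a := 0) (b := t - 1 - j) (p := ⟨0, by omega⟩)
      (by simp) (by simp))
  rw [hI, hAB] at e2
  rw [hE] at e3
  obtain ⟨e4⟩ := susp_homotopyEquiv (isBounded_realization _)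
    (isBounded_susp Bornology.isBounded_empty) ⟨e3⟩
  exact ⟨e1.trans (e2.trans e4)⟩

end Base
-- Fans of half-spheres and the homotopy types over `Fin n`
/-- `m + 1` half-spheres of dimension `d` glued along their common equator: `y` is the equatorial
coordinate, and the only nonzero coordinate of `z` is the height. -/
def fan (m d : ℕ) : Set ((Fin d → ℝ) × (Fin (m + 1) → ℝ)) :=
  {p | (∀ i, 0 ≤ p.2 i) ∧ (∀ i i', i ≠ i' → p.2 i * p.2 i' = 0) ∧ ∑ i, |p.1 i| + ∑ i, p.2 i = 1}

theorem isBounded_fan (m d : ℕ) : Bornology.IsBounded (fan m d) := by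
  refine isBounded_iff_forall_norm_le.2 ⟨1, ?_⟩
  rintro ⟨y, z⟩ ⟨h1, -, h3⟩
  simp only at h1 h3
  have hy : 0 ≤ ∑ i, |y i| := Finset.sum_nonneg fun i _ => abs_nonneg _
  have hz : 0 ≤ ∑ i, z i := Finset.sum_nonneg fun i _ => h1 i
  refine max_le ?_ ?_
  · rw [pi_norm_le_iff_of_nonneg zero_le_one]
    intro i
    have := Finset.single_le_sum (f := fun i => |y i|) (fun i _ => abs_nonneg _) (mem_univ i)
    rw [Real.norm_eq_abs]
    linarith
  · rw [pi_norm_le_iff_of_nonneg zero_le_one]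
    intro i
    have := Finset.single_le_sum (f := z) (fun i _ => h1 i) (mem_univ i)
    rw [Real.norm_of_nonneg (h1 i)]
    linarith

/-- The conditions defining a fan are homogeneous apart from the normalization, so rescaling by `1 -
|s|` only adds `|s|` to the sum. The suspension coordinate thus becomes one more equatorial
coordinate. -/
theorem mem_susp_fan {m d : ℕ} {y : Fin d → ℝ} {z : Fin (m + 1) → ℝ} {s : ℝ} :
    ((y, z), s) ∈ susp (fan m d) ↔ (∀ i, 0 ≤ z i) ∧ (∀ i i', i ≠ i' → z i * z i' = 0) ∧
      |s| + ∑ i, |y i| + ∑ i, z i = 1 := by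
  constructor
  · rintro ⟨h1, h2, h3⟩
    simp only at h1 h2 h3
    rcases h1.lt_or_eq with h | h
    · have hpos : 0 < 1 - |s| := by linarith
      obtain ⟨a, b, c⟩ := h3 h
      simp only [Prod.smul_mk, Pi.smul_apply, smul_eq_mul, abs_mul, ← Finset.mul_sum,
        abs_inv, abs_of_pos hpos, ← mul_add] at a b c
      refine ⟨fun i => nonneg_of_mul_nonneg_right (a i) (inv_pos.2 hpos), fun i i' hi => ?_, ?_⟩
      · have := b i i' hi
        have h4 := (inv_pos.2 hpos).ne'
        rw [mul_mul_mul_comm, mul_eq_zero] at this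
        exact this.resolve_left (mul_ne_zero h4 h4)
      · rw [inv_mul_eq_one₀ hpos.ne'] at c
        linarith
    · have := h2 h
      rw [Prod.mk_eq_zero] at this
      obtain ⟨rfl, rfl⟩ := this
      simp [h]
  · rintro ⟨h1, h2, h3⟩
    have hy : 0 ≤ ∑ i, |y i| := Finset.sum_nonneg fun i _ => abs_nonneg _
    have hz : 0 ≤ ∑ i, z i := Finset.sum_nonneg fun i _ => h1 i
    refine ⟨?_, ?_, ?_⟩
    · simp only; linarith
    · simp only
      intro h
      have hy0 : ∑ i, |y i| = 0 := by linarith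
      have hz0 : ∑ i, z i = 0 := by linarith
      rw [Finset.sum_eq_zero_iff_of_nonneg fun i _ => abs_nonneg _] at hy0
      rw [Finset.sum_eq_zero_iff_of_nonneg fun i _ => h1 i] at hz0
      ext i
      · simpa using hy0 i (mem_univ i)
      · exact hz0 i (mem_univ i)
    · simp only
      intro h
      have hpos : 0 < 1 - |s| := by linarith
      refine ⟨fun i => mul_nonneg (inv_nonneg.2 hpos.le) (h1 i), fun i i' hi => ?_, ?_⟩
      · simp only [Prod.smul_mk, Pi.smul_apply, smul_eq_mul]
        rw [mul_mul_mul_comm, h2 i i' hi, mul_zero]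
      · simp only [Prod.smul_mk, Pi.smul_apply, smul_eq_mul, abs_mul, ← Finset.mul_sum,
          abs_inv, abs_of_pos hpos, ← mul_add]
        rw [inv_mul_eq_one₀ hpos.ne']
        linarith

theorem susp_fan_homeomorph (m d : ℕ) : Nonempty (susp (fan m d) ≃ₜ fan m (d + 1)) := by
  refine ⟨⟨⟨fun p => ⟨(Fin.cons p.1.2 p.1.1.1, p.1.1.2), ?_⟩,
    fun p => ⟨((fun i => p.1.1 i.succ, p.1.2), p.1.1 0), ?_⟩, ?_, ?_⟩, ?_, ?_⟩⟩
  · obtain ⟨⟨⟨y, z⟩, s⟩, hp⟩ := p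
    obtain ⟨h1, h2, h3⟩ := mem_susp_fan.1 hp
    refine ⟨h1, h2, ?_⟩
    simpa [Fin.sum_univ_succ] using h3
  · obtain ⟨⟨y, z⟩, h1, h2, h3⟩ := p
    refine mem_susp_fan.2 ⟨h1, h2, ?_⟩
    simpa [Fin.sum_univ_succ] using h3
  · rintro ⟨⟨⟨y, z⟩, s⟩, hp⟩
    rfl
  · rintro ⟨⟨y, z⟩, hp⟩
    ext i
    · refine Fin.cases ?_ (fun i => ?_) i <;> simp
    · rfl
  · refine Continuous.subtype_mk (Continuous.prodMk (continuous_pi fun i => ?_) (by fun_prop)) _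
    refine Fin.cases ?_ (fun i => ?_) i
    · simp only [Fin.cons_zero]; fun_prop
    · simp only [Fin.cons_succ]; fun_prop
  · refine Continuous.subtype_mk ?_ _
    have hc : Continuous fun p : (Fin (d + 1) → ℝ) × (Fin (m + 1) → ℝ) =>
        ((fun i : Fin d => p.1 i.succ, p.2), p.1 0) := by fun_prop
    exact hc.comp continuous_subtype_val

theorem susp_homotopyEquiv_fan {E : Type*} [NormedAddCommGroup E] [NormedSpace ℝ E] {X : Set E}
    (hX : Bornology.IsBounded X) {m d : ℕ} (h : Nonempty (X ≃ₕ fan m d)) :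
    Nonempty (susp X ≃ₕ fan m (d + 1)) := by
  obtain ⟨e1⟩ := susp_homotopyEquiv hX (isBounded_fan m d) h
  obtain ⟨e2⟩ := susp_fan_homeomorph m d
  exact ⟨e1.trans e2.toHomotopyEquiv⟩

theorem susp_empty_homeomorph_fan {E : Type*} [NormedAddCommGroup E] [NormedSpace ℝ E] :
    Nonempty (susp (∅ : Set E) ≃ₜ fan 1 0) := by
  have hS : ∀ p ∈ susp (∅ : Set E), p.1 = 0 ∧ (p.2 = 1 ∨ p.2 = -1) := by
    rintro p ⟨h1, h2, h3⟩
    rcases h1.lt_or_eq with h | h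
    · exact absurd (h3 h) (Set.notMem_empty _)
    · exact ⟨h2 h, eq_or_eq_neg_of_abs_eq h⟩
  have hF : ∀ p ∈ fan 1 0, (p.2 0 = 1 ∧ p.2 1 = 0) ∨ (p.2 0 = 0 ∧ p.2 1 = 1) := by
    rintro p ⟨h1, h2, h3⟩
    have h4 : ∑ i : Fin 2, p.2 i = 1 := by simpa using h3
    rw [Fin.sum_univ_two] at h4
    rcases mul_eq_zero.1 (h2 0 1 (by decide)) with h | h
    · right; exact ⟨h, by linarith⟩
    · left; exact ⟨by linarith, h⟩
  refine ⟨⟨⟨fun p => ⟨(0, ![max p.1.2 0, max (-p.1.2) 0]), ?_⟩,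
    fun p => ⟨(0, p.1.2 0 - p.1.2 1), ?_⟩, ?_, ?_⟩, ?_, ?_⟩⟩
  · have h := (hS p.1 p.2).2
    refine ⟨?_, ?_, ?_⟩
    · simp [Fin.forall_fin_two]
    · rcases h with h | h <;> simp [Fin.forall_fin_two, h]
    · rcases h with h | h <;> simp [h]
  · rcases hF p.1 p.2 with ⟨h1, h2⟩ | ⟨h1, h2⟩ <;> simp [h1, h2, susp]
  · rintro ⟨p, hp⟩
    obtain ⟨h1, h2⟩ := hS p hp
    rcases h2 with h2 | h2 <;> simp [h2, Subtype.ext_iff, Prod.ext_iff, h1]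
  · rintro ⟨p, hp⟩
    rcases hF p hp with ⟨h1, h2⟩ | ⟨h1, h2⟩ <;>
      simp [Subtype.ext_iff, Prod.ext_iff, h1, h2, funext_iff, Fin.forall_fin_two]
  · refine Continuous.subtype_mk (Continuous.prodMk continuous_const (continuous_pi fun i => ?_)) _
    fin_cases i
    · simp only [Fin.zero_eta, Matrix.cons_val_zero]; fun_prop
    · simp only [Fin.mk_one, Matrix.cons_val_one]; fun_prop
  · refine Continuous.subtype_mk (Continuous.prodMk continuous_const ?_) _
    have hc : Continuous fun p : (Fin 0 → ℝ) × (Fin (1 + 1) → ℝ) => p.2 0 - p.2 1 := by fun_prop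
    exact hc.comp continuous_subtype_val

/-- The discrete complex. -/
def points (m : ℕ) : SimplicialComplex (Fin m) where
  carrier := {W | ∃ a, ∀ v ∈ W, v = a}
  lower' := fun _ _ h ⟨a, ha⟩ => ⟨a, fun v hv => ha v (h hv)⟩

theorem points_homeomorph_fan (m : ℕ) : Nonempty (realization (points (m + 1)) ≃ₜ fan m 0) := by
  refine ⟨⟨⟨fun x => ⟨(0, x.1), ?_⟩, fun p => ⟨p.1.2, ?_⟩, ?_, ?_⟩, ?_, ?_⟩⟩
  · obtain ⟨x, ⟨h1, h2⟩, σ, ⟨a, ha⟩, h3⟩ := x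
    refine ⟨h1, fun i i' hi => ?_, by simpa using h2⟩
    by_contra hne
    have hi1 : i ∈ σ := by_contra fun h => hne (by simp [h3 i h])
    have hi2 : i' ∈ σ := by_contra fun h => hne (by simp [h3 i' h])
    exact hi ((ha i hi1).trans (ha i' hi2).symm)
  · obtain ⟨⟨y, z⟩, h1, h2, h3⟩ := p
    simp only [univ_eq_empty, sum_empty, zero_add] at h3
    refine mem_realization.2 ⟨⟨h1, h3⟩, ?_⟩
    obtain ⟨a, -, ha⟩ : ∃ a ∈ univ, z a ≠ 0 := Finset.exists_ne_zero_of_sum_ne_zero (by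
      rw [h3]; exact one_ne_zero)
    refine ⟨a, fun v hv => by_contra fun hva => ?_⟩
    rcases mul_eq_zero.1 (h2 v a hva) with h | h
    · exact mem_supp.1 hv h
    · exact ha h
  · intro x; rfl
  · rintro ⟨⟨y, z⟩, hp⟩
    simp [Subsingleton.elim y 0]
  · exact Continuous.subtype_mk (by fun_prop) _
  · exact Continuous.subtype_mk (by fun_prop) _

/-- For `n = k + 1` the complement of an edge is a single vertex, so the complex is `k + 1 - j`
isolated points, which is the fan of dimension `0`. -/
theorem cycleComplex_homeomorph_fan {k j : ℕ} (hj : j < k) :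
    Nonempty (realization (cycleComplex (k + 1) k j) ≃ₜ fan (k - j) 0) := by
  obtain ⟨e1⟩ := cycleComplex_homeomorph_arcComplex (t := 0) hj
  obtain ⟨e3⟩ := points_homeomorph_fan (k - j)
  have e2 : Nonempty (realization (arcComplex (k + 1 + 0) 0 (k + 1 + 0 - j) 0) ≃ₜ
      realization (points (k - j + 1))) := by
    refine homeomorph_of_relabel (Fin.castLEEmb (by omega)) (fun W => ?_) (fun W hW v hv => ?_)
    · constructor
      · rintro ⟨a, ha⟩
        refine Or.inr ⟨a, by have := a.2; omega, ?_⟩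
        simp only [mem_map, forall_exists_index, and_imp, forall_apply_eq_imp_iff₂]
        intro v hv
        simp [ha v hv]
      · rintro (h | ⟨a, ha, h⟩)
        · refine ⟨0, fun v hv => ?_⟩
          have := h _ (mem_map_of_mem _ hv)
          simp only [Fin.castLEEmb_apply, Fin.val_castLE] at this
          ext
          simpa using this
        · refine ⟨⟨a, by omega⟩, fun v hv => ?_⟩
          have := h _ (mem_map_of_mem _ hv)
          simp only [Fin.castLEEmb_apply, Fin.val_castLE] at this
          ext
          simp only
          omega
    · have hv' : (v : ℕ) < k - j + 1 := by
        rcases hW with h | ⟨a, ha, h⟩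
        · have := h v hv; omega
        · have := h v hv; omega
      exact ⟨⟨v, hv'⟩, rfl⟩
  exact ⟨e1.trans (e2.some.trans e3)⟩

theorem cycleComplex_homotopyEquiv_fan_even {k j : ℕ} (hj : j < k) (q : ℕ) :
    Nonempty (realization (cycleComplex ((q + 1) * (k + 1)) k j) ≃ₕ fan (k - j) (2 * q)) := by
  induction q with
  | zero =>
    rw [zero_add, one_mul]
    exact ⟨(cycleComplex_homeomorph_fan hj).some.toHomotopyEquiv⟩
  | succ q ih =>
    rw [show (q + 1 + 1) * (k + 1) = (q + 1) * (k + 1) + k + 1 by ring]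
    obtain ⟨e1⟩ := cycleComplex_homotopyEquiv_susp_susp (n := (q + 1) * (k + 1)) (k := k) (j := j)
      (by nlinarith) hj
    obtain ⟨e2⟩ := susp_homotopyEquiv_fan (isBounded_susp (isBounded_realization _))
      (susp_homotopyEquiv_fan (isBounded_realization _) ih)
    exact ⟨e1.trans e2⟩

theorem cycleComplex_homotopyEquiv_fan_odd {k j t : ℕ} (hj : j < k) (hjt : j < t) (htk : t ≤ k)
    (q : ℕ) :
    Nonempty (realization (cycleComplex ((q + 1) * (k + 1) + t) k j) ≃ₕ fan 1 (2 * q + 1)) := by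
  induction q with
  | zero =>
    rw [zero_add, one_mul]
    obtain ⟨e1⟩ := cycleComplex_homotopyEquiv_susp_empty hj hjt htk
    obtain ⟨e2⟩ := susp_empty_homeomorph_fan (E := Fin (k + 1 + t) → ℝ)
    obtain ⟨e3⟩ := susp_homotopyEquiv_fan (isBounded_susp Bornology.isBounded_empty)
      ⟨e2.toHomotopyEquiv⟩
    exact ⟨e1.trans e3⟩
  | succ q ih =>
    rw [show (q + 1 + 1) * (k + 1) + t = ((q + 1) * (k + 1) + t) + k + 1 by ring]
    obtain ⟨e1⟩ := cycleComplex_homotopyEquiv_susp_susp (n := (q + 1) * (k + 1) + t) (k := k)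
      (j := j) (by nlinarith) hj
    obtain ⟨e2⟩ := susp_homotopyEquiv_fan (isBounded_susp (isBounded_realization _))
      (susp_homotopyEquiv_fan (isBounded_realization _) ih)
    exact ⟨e1.trans e2⟩

theorem cycleComplex_contractible {k j t : ℕ} (hj : j < k) (ht : 1 ≤ t) (htj : t ≤ j) (q : ℕ) :
    ContractibleSpace (realization (cycleComplex ((q + 1) * (k + 1) + t) k j)) := by
  induction q with
  | zero =>
    rw [zero_add, one_mul]
    exact cycleComplex_contractible_of_le hj ht htj
  | succ q ih =>
    rw [show (q + 1 + 1) * (k + 1) + t = ((q + 1) * (k + 1) + t) + k + 1 by ring]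
    have := susp_contractible
      (isBounded_realization (cycleComplex ((q + 1) * (k + 1) + t) k j))
    have := susp_contractible (isBounded_susp
      (isBounded_realization (cycleComplex ((q + 1) * (k + 1) + t) k j)))
    exact contractibleSpace_of_homotopyEquiv
      (cycleComplex_homotopyEquiv_susp_susp (by nlinarith) hj)

/-- Only the deleted edges, with starts `0, …, k - 1`, pass through vertex `k - 1`; hence it is an
apex. -/
theorem cycleComplex_contractible_of_ge {n k j : ℕ} (hk : 0 < k) (hkj : k ≤ j) (hjn : j < n) :
    ContractibleSpace (realization (cycleComplex n k j)) := by
  have hcone : IsCone (cycleComplex n k j) ⟨k - 1, by omega⟩ := by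
    refine ⟨⟨by simp, _, ⟨j, le_rfl, hjn, rfl⟩, ?_⟩, ?_⟩
    · intro v hv
      rw [mem_singleton] at hv
      simp only [hv, mem_arc]
      omega
    · rintro W ⟨h1, _, ⟨s, h2, h3, rfl⟩, h⟩
      refine ⟨by simp, _, ⟨s, h2, h3, rfl⟩, fun v hv => ?_⟩
      rcases mem_insert.1 hv with rfl | hv
      · simp only [mem_arc]
        omega
      · exact h v hv
  exact hcone.contractibleSpace

/-! ### From `ZMod n` to `Fin n` -/

theorem mem_noncoverComplex_tightCycleDel {n k j : ℕ} {W : Finset (ZMod n)} :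
    W ∈ noncoverComplex (tightCycleDel n k j) ↔
      ∃ e ∈ (tightCycleDel n k j).edgeSet, ∀ v ∈ W, v ∉ e := by
  change ((W : Set (ZMod n)) ⊆ Set.univ ∧ ¬IsCover _ _) ↔ _
  simp only [Set.subset_univ, true_and, IsCover, not_and, not_forall, Set.not_nonempty_iff_eq_empty,
    Set.eq_empty_iff_forall_notMem, Set.mem_inter_iff, Finset.mem_coe]
  constructor
  · intro h
    obtain ⟨e, he, h⟩ := h (Set.subset_univ _)
    exact ⟨e, he, h⟩
  · rintro ⟨e, he, h⟩ -
    exact ⟨e, he, h⟩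

theorem noncoverComplex_eq_bot (n k : ℕ) : noncoverComplex (tightCycleDel n k n) = ⊥ := by
  ext W
  simp only [SetLike.mem_coe, mem_noncoverComplex_tightCycleDel, LowerSet.notMem_bot, iff_false]
  rintro ⟨e, ⟨⟨i, hi, rfl⟩, h⟩, -⟩
  exact h ⟨i, hi, rfl⟩

theorem natCast_mem_tightEdge {n k i : ℕ} (hkn : k < n) (hi : i < n) (v : Fin n) :
    ((v : ℕ) : ZMod n) ∈ tightEdge n k i ↔ v ∈ arc n n k i := by
  have hv := v.2
  change (∃ a : ℕ, a < k ∧ ((v : ℕ) : ZMod n) = ((i + a : ℕ) : ZMod n)) ↔ _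
  simp only [mem_arc, ZMod.natCast_eq_natCast_iff, Nat.ModEq, Nat.mod_eq_of_lt hv]
  constructor
  · rintro ⟨a, ha, h⟩
    rcases lt_or_ge (i + a) n with h1 | h1
    · rw [Nat.mod_eq_of_lt h1] at h
      omega
    · rw [Nat.mod_eq_sub_mod h1, Nat.mod_eq_of_lt (by omega)] at h
      omega
  · rintro ⟨-, h | h⟩
    · refine ⟨v - i, by omega, ?_⟩
      rw [Nat.mod_eq_of_lt (by omega)]
      omega
    · refine ⟨v + n - i, by omega, ?_⟩
      rw [Nat.mod_eq_sub_mod (by omega), Nat.mod_eq_of_lt (by omega)]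
      omega

/-- As `0 < k < n`, the start is the only vertex of an edge whose predecessor is not in it.
Injectivity matters because edges are deleted as sets, so deleting the first `j` must not remove a
later one. -/
theorem tightEdge_injOn {n k i s : ℕ} (hk : 0 < k) (hkn : k < n) (hi : i < n) (hs : s < n)
    (h : tightEdge n k i = tightEdge n k s) : i = s := by
  have key : ∀ v : Fin n, v ∈ arc n n k i ↔ v ∈ arc n n k s := fun v => by
    rw [← natCast_mem_tightEdge hkn hi, ← natCast_mem_tightEdge hkn hs, h]
  have h1 := key ⟨i, hi⟩
  have h2 := key ⟨s, hs⟩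
  have h3 := key ⟨if i = 0 then n - 1 else i - 1, by split_ifs <;> omega⟩
  have h4 := key ⟨if s = 0 then n - 1 else s - 1, by split_ifs <;> omega⟩
  simp only [mem_arc] at h1 h2 h3 h4
  split_ifs at h3 h4 <;> omega

theorem noncoverComplex_homeomorph {n k j : ℕ} [NeZero n] (hk : 0 < k) (hkn : k < n)
    (hjn : j ≤ n) :
    Nonempty (realization (noncoverComplex (tightCycleDel n k j)) ≃ₜ
      realization (cycleComplex n k j)) := by
  have hinj : Function.Injective fun v : Fin n => ((v : ℕ) : ZMod n) := by
    intro v w h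
    have := congrArg ZMod.val h
    simp only [ZMod.val_natCast_of_lt v.2, ZMod.val_natCast_of_lt w.2] at this
    exact Fin.ext this
  refine homeomorph_of_relabel ⟨_, hinj⟩ (fun W => ?_)
    (fun W hW v hv => ⟨⟨v.val, v.val_lt⟩, by simp⟩)
  rw [mem_noncoverComplex_tightCycleDel]
  constructor
  · rintro ⟨-, _, ⟨s, h1, h2, rfl⟩, h⟩
    refine ⟨tightEdge n k s, ⟨⟨s, h2, rfl⟩, ?_⟩, ?_⟩
    · rintro ⟨i, hi, he⟩
      have := tightEdge_injOn hk hkn h2 (by omega) he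
      omega
    · simp only [mem_map, forall_exists_index, and_imp, forall_apply_eq_imp_iff₂]
      intro v hv hve
      exact h v hv ((natCast_mem_tightEdge hkn h2 v).1 hve)
  · rintro ⟨_, ⟨⟨s, h2, rfl⟩, hs⟩, h⟩
    refine ⟨by simp, _, ⟨s, ?_, h2, rfl⟩, fun v hv hva => ?_⟩
    · by_contra hlt
      exact hs ⟨s, by omega, rfl⟩
    · exact h _ (mem_map_of_mem _ hv) ((natCast_mem_tightEdge hkn h2 v).2 hva)

/-! ### Fans and wedges of spheres -/

/-- Two quotients of a compact space are homotopy equivalent if a homotopy of the space descends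
to both, and its final map factors through the coarser one. -/
theorem homotopyEquiv_of_quotients {S A B : Type*} [TopologicalSpace S] [CompactSpace S]
    [TopologicalSpace A] [T2Space A] [TopologicalSpace B] [T2Space B] {a : S → A} {b : S → B}
    (ha : Continuous a) (hb : Continuous b) (ha' : Function.Surjective a)
    (hb' : Function.Surjective b) (h : unitInterval × S → S) (hc : Continuous h)
    (h0 : ∀ s, h (0, s) = s)
    (haa : ∀ θ s s', a s = a s' → a (h (θ, s)) = a (h (θ, s')))
    (hbb : ∀ θ s s', b s = b s' → b (h (θ, s)) = b (h (θ, s')))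
    (hab : ∀ s s', a s = a s' → b s = b s')
    (hba : ∀ s s', b s = b s' → a (h (1, s)) = a (h (1, s'))) : Nonempty (A ≃ₕ B) := by
  have qa : Topology.IsQuotientMap a := ha.isClosedMap.isQuotientMap ha ha'
  have qb : Topology.IsQuotientMap b := hb.isClosedMap.isQuotientMap hb hb'
  have hIa : Continuous (Prod.map (id : unitInterval → unitInterval) a) := by fun_prop
  have hIb : Continuous (Prod.map (id : unitInterval → unitInterval) b) := by fun_prop
  -- Compactness of the source and Hausdorff targets make the product with the interval a quotient
  -- map too, so homotopies descend.
  have qIa := hIa.isClosedMap.isQuotientMap hIa (Function.surjective_id.prodMap ha')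
  have qIb := hIb.isClosedMap.isQuotientMap hIb (Function.surjective_id.prodMap hb')
  choose ra hra using ha'
  choose rb hrb using hb'
  have hfac : ∀ s, b (ra (a s)) = b s := fun s => hab _ _ (hra _)
  have gfac : ∀ s, a (h (1, rb (b s))) = a (h (1, s)) := fun s => hba _ _ (hrb _)
  have hf : Continuous fun x => b (ra x) := by
    rw [qa.continuous_iff]
    convert hb using 1
    funext s
    exact hfac s
  have hg : Continuous fun y => a (h (1, rb y)) := by
    rw [qb.continuous_iff]
    have : Continuous fun s => a (h (1, s)) := by fun_prop
    convert this using 1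
    funext s
    exact gfac s
  refine ⟨⟨⟨_, hf⟩, ⟨_, hg⟩, ⟨ContinuousMap.Homotopy.symm
    ⟨⟨fun p => a (h (p.1, ra p.2)), ?_⟩, ?_, ?_⟩⟩, ⟨ContinuousMap.Homotopy.symm
    ⟨⟨fun p => b (h (p.1, rb p.2)), ?_⟩, ?_, ?_⟩⟩⟩⟩
  · rw [qIa.continuous_iff]
    have : Continuous fun p => a (h p) := by fun_prop
    convert this using 1
    funext p
    exact haa _ _ _ (hra _)
  · intro x
    simp [h0, hra]
  · intro x
    exact (hba _ _ (hrb _)).symm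
  · rw [qIb.continuous_iff]
    have : Continuous fun p => b (h p) := by fun_prop
    convert this using 1
    funext p
    exact hbb _ _ _ (hrb _)
  · intro x
    simp [h0, hrb]
  · intro y
    exact (hab _ _ (hra _)).symm

section
variable {m d : ℕ}

theorem Sphere.norm_eq (x : Sphere d) : ‖x.1‖ = 1 := by simp

/-- Embedding of the wedge into a product of Euclidean spaces. -/
noncomputable def wedgeMap (m d : ℕ) :
    SphereWedge m d → Fin m → EuclideanSpace ℝ (Fin (d + 1)) :=
  Quot.lift (fun s => Pi.single s.1 (s.2.1 - (Sphere.base d).1)) (by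
    rintro _ _ ⟨i, i'⟩
    simp)

theorem continuous_wedgeMap : Continuous (wedgeMap m d) := by
  refine continuous_quot_lift _ ?_
  rw [continuous_sigma_iff]
  intro i
  refine continuous_pi fun l => ?_
  by_cases hl : l = i
  · subst hl
    simp only [Pi.single_eq_same]
    fun_prop
  · simp only [Pi.single_eq_of_ne hl]
    fun_prop

theorem wedgeMap_eq {s s' : Σ _ : Fin m, Sphere d}
    (h : wedgeMap m d (Quot.mk _ s) = wedgeMap m d (Quot.mk _ s')) :
    s = s' ∨ (s.2 = Sphere.base d ∧ s'.2 = Sphere.base d) := by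
  obtain ⟨i, x⟩ := s
  obtain ⟨i', x'⟩ := s'
  simp only [wedgeMap] at h
  by_cases hi : i = i'
  · subst hi
    left
    have := congrFun h i
    simp only [Pi.single_eq_same] at this
    rw [Subtype.ext (sub_left_injective this)]
  · right
    have h1 := congrFun h i
    have h2 := congrFun h i'
    simp only [Pi.single_eq_same, Pi.single_eq_of_ne hi, Pi.single_eq_of_ne (Ne.symm hi)] at h1 h2
    exact ⟨Subtype.ext (sub_eq_zero.1 h1), Subtype.ext (sub_eq_zero.1 h2.symm)⟩

theorem wedge_mk_eq {s s' : Σ _ : Fin m, Sphere d}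
    (h : s = s' ∨ (s.2 = Sphere.base d ∧ s'.2 = Sphere.base d)) :
    (Quot.mk _ s : SphereWedge m d) = Quot.mk _ s' := by
  rcases h with rfl | ⟨h1, h2⟩
  · rfl
  · obtain ⟨i, x⟩ := s
    obtain ⟨i', x'⟩ := s'
    simp only at h1 h2
    subst h1 h2
    exact Quot.sound (WedgeRel.glue i i')

theorem wedgeMap_injective : Function.Injective (wedgeMap m d) := by
  intro p p' h
  induction p using Quot.ind
  induction p' using Quot.ind
  exact wedge_mk_eq (wedgeMap_eq h)

/-- Needed so that the projection from the compact union of spheres falls under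
`homotopyEquiv_of_quotients`. -/
instance : T2Space (SphereWedge m d) :=
  T2Space.of_injective_continuous wedgeMap_injective continuous_wedgeMap

theorem sphereWedge_one_homeomorph (d : ℕ) : Nonempty (SphereWedge 1 d ≃ₜ Sphere d) := by
  refine ⟨⟨⟨Quot.lift (fun s => s.2) ?_, fun x => Quot.mk _ ⟨0, x⟩, ?_, ?_⟩, ?_, ?_⟩⟩
  · rintro _ _ ⟨i, i'⟩
    rfl
  · intro p
    induction p using Quot.ind with
    | mk s =>
      obtain ⟨i, x⟩ := s
      rw [Subsingleton.elim i 0]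
  · intro x
    rfl
  · refine continuous_quot_lift _ ?_
    rw [continuous_sigma_iff]
    intro i
    exact continuous_id
  · exact continuous_quot_mk.comp (continuous_sigmaMk (σ := fun _ : Fin 1 => Sphere d))

/-- The vector with first coordinate `c` and remaining coordinates `y`. -/
noncomputable def vec (c : ℝ) (y : Fin d → ℝ) : EuclideanSpace ℝ (Fin (d + 1)) :=
  WithLp.toLp 2 (Fin.cons c y)

@[simp] theorem vec_zero (c : ℝ) (y : Fin d → ℝ) : vec c y 0 = c := rfl
@[simp] theorem vec_succ (c : ℝ) (y : Fin d → ℝ) (i : Fin d) : vec c y i.succ = y i := rfl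

theorem continuous_vec {X : Type*} [TopologicalSpace X] {c : X → ℝ} {y : X → Fin d → ℝ}
    (hc : Continuous c) (hy : Continuous y) : Continuous fun x => vec (c x) (y x) := by
  refine (PiLp.continuous_toLp 2 _).comp (continuous_pi fun i => ?_)
  refine Fin.cases ?_ (fun i => ?_) i
  · simpa using hc
  · exact (continuous_apply i).comp hy

theorem base_eq_vec (d : ℕ) : (Sphere.base d).1 = vec 1 0 := by
  ext i
  refine Fin.cases ?_ (fun i => ?_) i
  · simp [Sphere.base]
  · simp [Sphere.base]

/-- A map that collapses the half-space of nonnegative first coordinate onto a ray. -/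
noncomputable def collapseHalf (x : EuclideanSpace ℝ (Fin (d + 1))) :
    EuclideanSpace ℝ (Fin (d + 1)) :=
  vec (1 - 2 * max (-x 0) 0) fun i => max (-x 0) 0 * x i.succ

theorem continuous_collapseHalf : Continuous (collapseHalf (d := d)) :=
  continuous_vec (by fun_prop) (by fun_prop)

/-- If all coordinates after the first vanish, `x` is a pole, which the collapse fixes. Otherwise a
zero forces `θ = 1` and nonnegative first coordinate, where the collapse takes the value `(1, 0, …,
0)`. -/
theorem segment_collapseHalf_ne_zero (x : Sphere d) {θ : ℝ} (h0 : 0 ≤ θ) (h1 : θ ≤ 1) :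
    (1 - θ) • x.1 + θ • collapseHalf x.1 ≠ 0 := by
  intro h
  have hz := congrArg (fun v : EuclideanSpace ℝ (Fin (d + 1)) => v 0) h
  have hs : ∀ i : Fin d, ((1 - θ) + θ * max (-x.1 0) 0) * x.1 i.succ = 0 := fun i => by
    have := congrArg (fun v : EuclideanSpace ℝ (Fin (d + 1)) => v i.succ) h
    simp only [collapseHalf, PiLp.add_apply, PiLp.smul_apply, smul_eq_mul, vec_succ,
      PiLp.zero_apply] at this
    linarith
  simp only [collapseHalf, PiLp.add_apply, PiLp.smul_apply, smul_eq_mul, vec_zero,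
    PiLp.zero_apply] at hz
  have hg : 0 ≤ max (-x.1 0) 0 := le_max_right _ _
  by_cases hy : ∀ i : Fin d, x.1 i.succ = 0
  · have hn := x.norm_eq
    rw [EuclideanSpace.norm_eq, Fin.sum_univ_succ] at hn
    simp only [hy, norm_zero, Real.norm_eq_abs, sq_abs, Real.sqrt_eq_one] at hn
    have hsq : (x.1 0) ^ 2 = 1 := by simpa using hn
    rcases mul_self_eq_one_iff.1 ((sq _).symm.trans hsq) with h2 | h2
    · rw [h2] at hz
      norm_num at hz
    · rw [h2] at hz
      norm_num at hz
      linarith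
  · push Not at hy
    obtain ⟨i, hi⟩ := hy
    have h3 := (mul_eq_zero.1 (hs i)).resolve_right hi
    have h4 : 0 ≤ θ * max (-x.1 0) 0 := mul_nonneg h0 hg
    have h5 : θ = 1 := by linarith
    subst h5
    have h6 : max (-x.1 0) 0 = 0 := by linarith
    rw [h6] at hz
    norm_num at hz

/-- The normalized straight-line homotopy from the identity to the collapse of a hemisphere. -/
noncomputable def hemiHomotopy (θ : unitInterval) (x : Sphere d) : Sphere d :=
  ⟨‖(1 - (θ : ℝ)) • x.1 + (θ : ℝ) • collapseHalf x.1‖⁻¹ •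
    ((1 - (θ : ℝ)) • x.1 + (θ : ℝ) • collapseHalf x.1), by
      have := segment_collapseHalf_ne_zero x θ.2.1 θ.2.2
      rw [mem_sphere_zero_iff_norm, norm_smul, norm_inv, norm_norm,
        inv_mul_cancel₀ (norm_ne_zero_iff.2 this)]⟩

theorem continuous_hemiHomotopy :
    Continuous fun p : unitInterval × Sphere d => hemiHomotopy p.1 p.2 := by
  have hcol := continuous_collapseHalf (d := d)
  have hc : Continuous fun p : unitInterval × Sphere d =>
      (1 - (p.1 : ℝ)) • p.2.1 + (p.1 : ℝ) • collapseHalf p.2.1 := by fun_prop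
  refine Continuous.subtype_mk (Continuous.smul (Continuous.inv₀ hc.norm fun p => ?_) hc) _
  exact norm_ne_zero_iff.2 (segment_collapseHalf_ne_zero p.2 p.1.2.1 p.1.2.2)

theorem collapseHalf_of_nonneg {x : EuclideanSpace ℝ (Fin (d + 1))} (h : 0 ≤ x 0) :
    collapseHalf x = (Sphere.base d).1 := by
  have : max (-x 0) 0 = 0 := max_eq_right (by linarith)
  rw [base_eq_vec, collapseHalf, this]
  simp only [mul_zero, sub_zero, zero_mul]
  rfl

theorem base_apply_zero (d : ℕ) : (Sphere.base d).1 0 = 1 := by simp [Sphere.base]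

theorem hemiHomotopy_base (θ : unitInterval) :
    hemiHomotopy θ (Sphere.base d) = Sphere.base d := by
  ext1
  simp only [hemiHomotopy]
  rw [collapseHalf_of_nonneg (by rw [base_apply_zero]; exact zero_le_one), ← add_smul]
  simp

theorem hemiHomotopy_zero (x : Sphere d) : hemiHomotopy 0 x = x := by
  ext1
  simp [hemiHomotopy]

theorem hemiHomotopy_one {x : Sphere d} (h : 0 ≤ x.1 0) : hemiHomotopy 1 x = Sphere.base d := by
  ext1
  simp [hemiHomotopy, collapseHalf_of_nonneg h]

theorem hemiHomotopy_nonneg (θ : unitInterval) {x : Sphere d} (h : 0 ≤ x.1 0) :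
    0 ≤ (hemiHomotopy θ x).1 0 := by
  simp only [hemiHomotopy, collapseHalf_of_nonneg h, PiLp.smul_apply, PiLp.add_apply, smul_eq_mul,
    base_apply_zero]
  have h1 := θ.2.1
  have h2 := θ.2.2
  have : 0 ≤ (1 - (θ : ℝ)) * x.1 0 := mul_nonneg (by linarith) h
  exact mul_nonneg (inv_nonneg.2 (norm_nonneg _)) (by linarith)

/-- The height coordinates in the fan of a point of the `i`-th sphere. -/
noncomputable def heights (i : Fin m) (c : ℝ) : Fin (m + 1) → ℝ :=
  Fin.cons (max c 0) (Pi.single i (max (-c) 0))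

theorem heights_nonneg (i : Fin m) (c : ℝ) (l : Fin (m + 1)) : 0 ≤ heights i c l := by
  refine Fin.cases ?_ (fun l => ?_) l
  · simp [heights]
  · by_cases h : l = i
    · subst h; simp [heights]
    · simp [heights, h]

theorem heights_mul (i : Fin m) (c : ℝ) (l l' : Fin (m + 1)) (h : l ≠ l') :
    heights i c l * heights i c l' = 0 := by
  have hmm : max c 0 * max (-c) 0 = 0 := by
    rcases le_total 0 c with h | h
    · simp [h]
    · simp [h]
  have key : ∀ l : Fin m, heights i c 0 * heights i c l.succ = 0 := by
    intro l
    by_cases hl : l = i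
    · subst hl; simpa [heights] using hmm
    · simp [heights, hl]
  induction l using Fin.cases with
  | zero =>
    induction l' using Fin.cases with
    | zero => exact absurd rfl h
    | succ l' => exact key l'
  | succ l =>
    induction l' using Fin.cases with
    | zero => rw [mul_comm]; exact key l
    | succ l' =>
      by_cases hl : l = i
      · have : l' ≠ i := fun h' => h (by rw [hl, h'])
        simp [heights, this]
      · simp [heights, hl]

theorem sum_heights (i : Fin m) (c : ℝ) : ∑ l, heights i c l = |c| := by
  rw [Fin.sum_univ_succ]
  simp only [heights, Fin.cons_zero, Fin.cons_succ, Finset.sum_pi_single', mem_univ, if_true]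
  rcases le_total 0 c with h | h
  · simp [h, abs_of_nonneg h]
  · simp [h, abs_of_nonpos h]

theorem heights_smul (i : Fin m) {r : ℝ} (hr : 0 ≤ r) (c : ℝ) :
    r • heights i c = heights i (r * c) := by
  have h1 : ∀ c : ℝ, r * max c 0 = max (r * c) 0 := fun c => by
    rw [mul_max_of_nonneg _ _ hr, mul_zero]
  ext l
  refine Fin.cases ?_ (fun l => ?_) l
  · simp [heights, h1]
  · by_cases h : l = i
    · subst h; simp [heights, h1]
    · simp [heights, h]

theorem continuous_heights (i : Fin m) : Continuous (heights i) := by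
  refine continuous_pi fun l => ?_
  refine Fin.cases ?_ (fun l => ?_) l
  · simp only [heights, Fin.cons_zero]; fun_prop
  · by_cases h : l = i
    · subst h; simp only [heights, Fin.cons_succ, Pi.single_eq_same]; fun_prop
    · simp only [heights, Fin.cons_succ, Pi.single_eq_of_ne h]; fun_prop

/-- The sum of the absolute values of the coordinates. -/
noncomputable def oneNorm (x : EuclideanSpace ℝ (Fin (d + 1))) : ℝ := ∑ i, |x i|

theorem oneNorm_pos {x : EuclideanSpace ℝ (Fin (d + 1))} (hx : x ≠ 0) : 0 < oneNorm x := by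
  have h0 : 0 ≤ oneNorm x := Finset.sum_nonneg fun i _ => abs_nonneg _
  refine h0.lt_of_ne fun h => hx ?_
  have := (Finset.sum_eq_zero_iff_of_nonneg fun i _ => abs_nonneg _).1 h.symm
  ext i
  simpa using this i (mem_univ i)

theorem Sphere.ne_zero (x : Sphere d) : x.1 ≠ 0 := by
  intro h
  have := x.norm_eq
  rw [h, norm_zero] at this
  exact zero_ne_one this

/-- The `i`-th sphere mapped onto the union of the half-spheres `0` and `i + 1` of the fan. -/
noncomputable def toFan (s : Σ _ : Fin m, Sphere d) : fan m d :=
  ⟨((oneNorm s.2.1)⁻¹ • fun l => s.2.1 l.succ, (oneNorm s.2.1)⁻¹ • heights s.1 (s.2.1 0)), by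
    have hpos := oneNorm_pos s.2.ne_zero
    have hr : 0 ≤ (oneNorm s.2.1)⁻¹ := (inv_pos.2 hpos).le
    refine ⟨fun i => ?_, fun i i' h => ?_, ?_⟩
    · exact mul_nonneg hr (heights_nonneg _ _ _)
    · simp only [heights_smul _ hr]
      exact heights_mul _ _ _ _ h
    · simp only [Pi.smul_apply, smul_eq_mul, abs_mul, abs_of_nonneg hr, ← Finset.mul_sum,
        sum_heights, ← mul_add]
      rw [inv_mul_eq_one₀ hpos.ne', oneNorm, Fin.sum_univ_succ, add_comm]⟩

theorem continuous_toFan : Continuous (toFan (m := m) (d := d)) := by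
  rw [continuous_sigma_iff]
  intro i
  have h1 : Continuous fun x : Sphere d => oneNorm x.1 := by
    unfold oneNorm; fun_prop
  have h2 : Continuous fun x : Sphere d => (oneNorm x.1)⁻¹ :=
    h1.inv₀ fun x => (oneNorm_pos x.ne_zero).ne'
  have h3 : Continuous fun x : Sphere d => heights i (x.1 0) :=
    (continuous_heights i).comp (by fun_prop)
  refine Continuous.subtype_mk (Continuous.prodMk (h2.smul (by fun_prop)) (h2.smul h3)) _

/-- Equal signed heights and equatorial parts make the two points proportional, hence equal on the
unit sphere; the index is lost only on the closed upper hemisphere, which all spheres share. -/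
theorem toFan_eq {s s' : Σ _ : Fin m, Sphere d} (h : toFan s = toFan s') :
    s.2 = s'.2 ∧ (s.1 = s'.1 ∨ 0 ≤ s.2.1 0) := by
  obtain ⟨i, x⟩ := s
  obtain ⟨i', x'⟩ := s'
  have hp := oneNorm_pos x.ne_zero
  have hp' := oneNorm_pos x'.ne_zero
  set r := (oneNorm x.1)⁻¹ with hr
  set r' := (oneNorm x'.1)⁻¹ with hr'
  have hr0 : 0 < r := inv_pos.2 hp
  have hr0' : 0 < r' := inv_pos.2 hp'
  have h1 := congrArg (fun p : fan m d => p.1.1) h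
  have h2 := congrArg (fun p : fan m d => p.1.2) h
  simp only [toFan, ← hr, ← hr', heights_smul _ hr0.le, heights_smul _ hr0'.le] at h1 h2
  have h3 : max (r * x.1 0) 0 = max (r' * x'.1 0) 0 := by
    simpa [heights] using congrFun h2 0
  have h4 : |r * x.1 0| = |r' * x'.1 0| := by
    rw [← sum_heights i, ← sum_heights i', h2]
  have h5 : r * x.1 0 = r' * x'.1 0 := by
    rcases le_total 0 (r * x.1 0) with ha | ha <;> rcases le_total 0 (r' * x'.1 0) with hb | hb
    · simpa [ha, hb] using h3
    · rw [max_eq_left ha, max_eq_right hb] at h3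
      rw [h3, abs_zero, eq_comm, abs_eq_zero] at h4
      rw [h3, h4]
    · rw [max_eq_right ha, max_eq_left hb] at h3
      rw [← h3, abs_zero, abs_eq_zero] at h4
      rw [← h3, h4]
    · rw [abs_of_nonpos ha, abs_of_nonpos hb] at h4
      linarith
  have h6 : r • x.1 = r' • x'.1 := by
    ext l
    refine Fin.cases ?_ (fun l => ?_) l
    · simpa using h5
    · simpa using congrFun h1 l
  have h7 : r = r' := by
    have := congrArg norm h6
    rwa [norm_smul, norm_smul, x.norm_eq, x'.norm_eq, mul_one, mul_one,
      Real.norm_of_nonneg hr0.le, Real.norm_of_nonneg hr0'.le] at this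
  have h8 : x = x' := by
    rw [h7] at h6
    exact Subtype.ext (smul_right_injective _ hr0'.ne' h6)
  refine ⟨h8, ?_⟩
  by_cases hi : i = i'
  · exact Or.inl hi
  · right
    have h9 := congrFun h2 i.succ
    simp only [heights, Fin.cons_succ, Pi.single_eq_same, Pi.single_eq_of_ne hi] at h9
    have h10 : 0 ≤ r * x.1 0 := by
      have := le_max_left (-(r * x.1 0)) 0
      linarith
    exact nonneg_of_mul_nonneg_right h10 hr0

theorem toFan_congr {i i' : Fin m} {x : Sphere d} (h : 0 ≤ x.1 0) :
    toFan ⟨i, x⟩ = toFan ⟨i', x⟩ := by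
  have : heights i (x.1 0) = heights i' (x.1 0) := by
    simp [heights, h]
  ext1
  simp only [toFan, this]

theorem toFan_surjective (hm : 0 < m) : Function.Surjective (toFan (m := m) (d := d)) := by
  rintro ⟨⟨y, z⟩, h1, h2, h3⟩
  simp only at h1 h2 h3
  -- At most one height is nonzero, so some sphere carries the point; if every height with positive
  -- index vanishes, any sphere does, and `0 < m` provides one.
  obtain ⟨i, hi⟩ : ∃ i : Fin m, ∀ l, l ≠ i → z l.succ = 0 := by
    by_cases h : ∃ i : Fin m, z i.succ ≠ 0
    · obtain ⟨i, hi⟩ := h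
      refine ⟨i, fun l hl => ?_⟩
      exact (mul_eq_zero.1 (h2 l.succ i.succ (by simpa using hl))).resolve_right hi
    · push Not at h
      exact ⟨⟨0, hm⟩, fun l _ => h l⟩
  have hz : heights i (z 0 - z i.succ) = z := by
    have h0 : z 0 = 0 ∨ z i.succ = 0 := mul_eq_zero.1 (h2 0 i.succ (Fin.succ_ne_zero i).symm)
    ext l
    refine Fin.cases ?_ (fun l => ?_) l
    · rcases h0 with h0 | h0 <;> simp [heights, h0, h1]
    · by_cases hl : l = i
      · subst hl
        rcases h0 with h0 | h0 <;> simp [heights, h0, h1]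
      · simp [heights, hl, hi l hl]
  set x := vec (z 0 - z i.succ) y with hx
  have hone : oneNorm x = 1 := by
    rw [oneNorm, Fin.sum_univ_succ]
    simp only [hx, vec_zero, vec_succ]
    rw [← sum_heights i, hz]
    linarith
  have hx0 : x ≠ 0 := by
    intro h
    rw [h] at hone
    simp [oneNorm] at hone
  have hn : 0 < ‖x‖⁻¹ := inv_pos.2 (norm_pos_iff.2 hx0)
  refine ⟨⟨i, ⟨‖x‖⁻¹ • x, ?_⟩⟩, ?_⟩
  · rw [mem_sphere_zero_iff_norm, norm_smul, norm_inv, norm_norm,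
      inv_mul_cancel₀ (norm_ne_zero_iff.2 hx0)]
  · have hone' : oneNorm (‖x‖⁻¹ • x) = ‖x‖⁻¹ := by
      simp only [oneNorm, PiLp.smul_apply, smul_eq_mul, abs_mul, abs_of_pos hn, ← Finset.mul_sum]
      rw [show ∑ i, |x i| = 1 from hone, mul_one]
    ext l
    · simp only [toFan, hone', inv_inv, Pi.smul_apply, PiLp.smul_apply, smul_eq_mul]
      rw [mul_inv_cancel_left₀ (norm_ne_zero_iff.2 hx0)]
      simp [hx]
    · simp only [toFan, hone', inv_inv, PiLp.smul_apply, smul_eq_mul]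
      rw [heights_smul _ (norm_nonneg _), mul_inv_cancel_left₀ (norm_ne_zero_iff.2 hx0)]
      simp only [hx, vec_zero, hz]

/-- Both spaces are quotients of `m` disjoint spheres: the wedge identifies the base points, the fan
identifies the whole closed upper hemispheres. The homotopy contracting those hemispheres to the
base point respects both identifications. -/
theorem sphereWedge_homotopyEquiv_fan (hm : 0 < m) (d : ℕ) :
    Nonempty (SphereWedge m d ≃ₕ fan m d) := by
  have hinj : ∀ {s s' : Σ _ : Fin m, Sphere d},
      (Quot.mk (WedgeRel fun _ : Fin m => Sphere.base d) s) = Quot.mk _ s' →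
      s = s' ∨ (s.2 = Sphere.base d ∧ s'.2 = Sphere.base d) :=
    fun h => wedgeMap_eq (congrArg (wedgeMap m d) h)
  have hsig : Continuous fun s : Fin m × Sphere d => (⟨s.1, s.2⟩ : Σ _ : Fin m, Sphere d) := by
    rw [continuous_prod_of_discrete_left]
    exact fun i => continuous_sigmaMk (σ := fun _ : Fin m => Sphere d)
  have hsurj : Function.Surjective
      fun s : Fin m × Sphere d => (⟨s.1, s.2⟩ : Σ _ : Fin m, Sphere d) :=
    fun s => ⟨(s.1, s.2), rfl⟩
  have hhom : Continuous fun p : unitInterval × Fin m × Sphere d =>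
      (p.2.1, hemiHomotopy p.1 p.2.2) := by
    have h1 : Continuous fun p : unitInterval × Fin m × Sphere d => (p.1, p.2.2) := by fun_prop
    have h2 : Continuous ((fun q : unitInterval × Sphere d => hemiHomotopy q.1 q.2) ∘
        fun p : unitInterval × Fin m × Sphere d => (p.1, p.2.2)) :=
      (continuous_hemiHomotopy (d := d)).comp h1
    have h3 : Continuous fun p : unitInterval × Fin m × Sphere d => p.2.1 := by fun_prop
    exact h3.prodMk h2
  refine homotopyEquiv_of_quotients (S := Fin m × Sphere d)
    (a := fun s => Quot.mk (WedgeRel fun _ : Fin m => Sphere.base d) ⟨s.1, s.2⟩)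
    (b := fun s => toFan ⟨s.1, s.2⟩) (continuous_quot_mk.comp hsig) (continuous_toFan.comp hsig)
    (Quot.mk_surjective.comp hsurj) ((toFan_surjective hm).comp hsurj)
    (fun p => (p.2.1, hemiHomotopy p.1 p.2.2)) ?_ ?_ ?_ ?_ ?_ ?_
  · exact hhom
  · rintro ⟨i, x⟩
    simp [hemiHomotopy_zero]
  · rintro θ ⟨i, x⟩ ⟨i', x'⟩ h
    refine wedge_mk_eq ?_
    rcases hinj h with h | ⟨h1, h2⟩
    · cases h
      exact Or.inl rfl
    · simp only at h1 h2
      exact Or.inr ⟨by simp only [h1, hemiHomotopy_base], by simp only [h2, hemiHomotopy_base]⟩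
  · rintro θ ⟨i, x⟩ ⟨i', x'⟩ h
    obtain ⟨h1, h2⟩ := toFan_eq h
    simp only at h1 h2
    subst h1
    rcases h2 with rfl | h2
    · rfl
    · exact toFan_congr (hemiHomotopy_nonneg θ h2)
  · rintro ⟨i, x⟩ ⟨i', x'⟩ h
    rcases hinj h with h | ⟨h1, h2⟩
    · cases h
      rfl
    · simp only at h1 h2
      subst h1 h2
      exact toFan_congr (by rw [base_apply_zero]; exact zero_le_one)
  · rintro ⟨i, x⟩ ⟨i', x'⟩ h
    obtain ⟨h1, h2⟩ := toFan_eq h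
    simp only at h1 h2
    subst h1
    rcases h2 with rfl | h2
    · rfl
    · exact wedge_mk_eq (Or.inr ⟨hemiHomotopy_one h2, hemiHomotopy_one h2⟩)

end
end Noncover

/-! ### Assembly of the cases -/

open Noncover in
open scoped ContinuousMap in
theorem mainTheorem5 (n k j : ℕ) [NeZero n] (hk : 0 < k) (hkn : k < n) (hjn : j ≤ n) :
    (j = n → noncoverComplex (tightCycleDel n k j) = ⊥) ∧
    (k ≤ j → j < n → ContractibleSpace (realization (noncoverComplex (tightCycleDel n k j)))) ∧
    (j ≤ k - 1 →
      (∀ q : ℕ, n = (q + 1) * (k + 1) →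
        Nonempty (realization (noncoverComplex (tightCycleDel n k j)) ≃ₕ
          SphereWedge (k - j) (2 * q))) ∧
      (∀ q t : ℕ, j < t → t ≤ k → n = (q + 1) * (k + 1) + t →
        Nonempty (realization (noncoverComplex (tightCycleDel n k j)) ≃ₕ Sphere (2 * q + 1))) ∧
      ((¬ ∃ q : ℕ, n = (q + 1) * (k + 1)) →
        (¬ ∃ q t : ℕ, j < t ∧ t ≤ k ∧ n = (q + 1) * (k + 1) + t) →
        ContractibleSpace (realization (noncoverComplex (tightCycleDel n k j))))) := by
  obtain ⟨e⟩ := noncoverComplex_homeomorph hk hkn hjn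
  refine ⟨?_, fun hkj hjn' => ?_, fun hj => ⟨?_, ?_, fun h1 h2 => ?_⟩⟩
  · rintro rfl
    exact noncoverComplex_eq_bot _ _
  · have := cycleComplex_contractible_of_ge hk hkj hjn'
    exact contractibleSpace_of_homotopyEquiv ⟨e.toHomotopyEquiv⟩
  · rintro q rfl
    obtain ⟨e1⟩ := cycleComplex_homotopyEquiv_fan_even (show j < k by omega) q
    obtain ⟨e2⟩ := sphereWedge_homotopyEquiv_fan (show 0 < k - j by omega) (2 * q)
    exact ⟨e.toHomotopyEquiv.trans (e1.trans e2.symm)⟩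
  · rintro q t hjt htk rfl
    obtain ⟨e1⟩ := cycleComplex_homotopyEquiv_fan_odd (show j < k by omega) hjt htk q
    obtain ⟨e2⟩ := sphereWedge_homotopyEquiv_fan one_pos (2 * q + 1)
    obtain ⟨e3⟩ := sphereWedge_one_homeomorph (2 * q + 1)
    exact ⟨e.toHomotopyEquiv.trans (e1.trans (e2.symm.trans e3.toHomotopyEquiv))⟩
  -- Division by `k + 1`, with quotient at least `1` because `k < n`; the excluded cases leave
  -- exactly the remainders `1 ≤ t ≤ j`.
  · obtain ⟨q, t, ht, hn⟩ : ∃ q t, t ≤ k ∧ n = (q + 1) * (k + 1) + t := by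
      have h3 := Nat.div_add_mod n (k + 1)
      have h4 := Nat.mod_lt n (Nat.succ_pos k)
      have h5 : 1 ≤ n / (k + 1) := (Nat.one_le_div_iff (Nat.succ_pos k)).2 hkn
      refine ⟨n / (k + 1) - 1, n % (k + 1), Nat.le_of_lt_succ h4, ?_⟩
      rw [Nat.sub_add_cancel h5, mul_comm]
      exact h3.symm
    have ht0 : 1 ≤ t := by
      by_contra h
      exact h1 ⟨q, by rw [hn]; omega⟩
    have htj : t ≤ j := by
      by_contra h
      exact h2 ⟨q, t, by omega, ht, hn⟩
    subst hn
    have := cycleComplex_contractible (show j < k by omega) ht0 htj q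
    exact contractibleSpace_of_homotopyEquiv ⟨e.toHomotopyEquiv⟩
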